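/- Let $\mathbb{F}_q$ be a finite field with $q$ elements, and let $\mathbb{B}(q)$ be the poset of all finite dimensional subspaces of $\mathbb{F}_q^{\mathbb{N}}$, ordered by inclusion. All posets considered have a least element, and the quasi-rank $\rho(x)$ of an element is the largest $k$ for which there is a chain $x_0<x_1<\cdots<x_k=x$. A locally finite poset is quasi-rank uniform if, for all $k$, the number of elements of quasi-rank $k$ below $x$ depends only on $\rho(x)$ (and $k$). For a quasi-rank uniform poset $P$ let $R(P)=(r_{n,k})$, where $r_{n,k}$ is the number of elements of quasi-rank $k$ below any element of quasi-rank $n$; $P$ is a TN-poset if all minors of $R(P)$ are nonnegative. For a TN-poset $P$ of rank $N\in\mathbb{N}\cup\{\infty\}$ let $R_{n,k}(t)$, $0\le k\le n\le N$, be the unique monic polynomials, with $t^k\mid R_{n,k}(t)$, for which $R_{n,0}(t)=\sum_k r_{n,k}t^k$, $R_{n,n}(t)=t^n$, and $R_{n+1,k}(t)=R_{n+1,k+1}(t)+\lambda_{n,k}R_{n,k}(t)$ for $0\le k\le n<N$, for some nonnegative numbers $\lambda_{n,k}$ such that $\lambda_{n,k}=0$ implies $\lambda_{n+1,k}=0$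 whenever $0\le k\le n<N-1$. A finite quasi-rank uniform poset $Q$ of rank $r$ is $P$-positive if $\sum_{x\le y}t^{\rho(x)}=R_{\rho(y),0}(t)$ for all $y\in Q$, and $f_Q(t)=\sum_{x\in Q}t^{\rho(x)}$ equals $\sum_{k=0}^r h_kR_{r,k}(t)$ for some numbers $h_k\ge 0$. A $q$-poset is a quasi-rank uniform poset each of whose principal order ideals $\langle x\rangle=\{z : z\le x\}$ is isomorphic to a principal order ideal of $\mathbb{B}(q)$, i.e. to the lattice of subspaces of a finite dimensional vector space over $\mathbb{F}_q$. A finite ranked poset is pure of rank $n$ if all its maximal elements (facets) have rank $n$. A pure $q$-poset of rank $n$ is shellable if its facets admit an ordering $F_1,\ldots,F_m$ such that for each $k>1$ the poset $(\langle F_1\rangle\cup\cdots\cup\langle F_{k-1}\rangle)\cap\langle F_k\rangle$ is pure of rank $n-1$. Theorem. Let $P$ be a shellable $q$-poset of rank $n$. Then $P$ is $\mathbb{B}(q)$-positive. Moreover, with $R^q_{n,k}(t)=(t+\alpha)^{n-k}t^k$, where $(\alpha f)(t)=f(qt)$, there is a unique vector $(h_0,\ldots,h_n)\in\mathbb{R}^{n+1}$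 (the $h$-vector of $P$) such that $$\sum_{x\in P}t^{\rho(x)}=\sum_{k=0}^n h_k\,R^q_{n,k}(t),$$ and $h_k\ge 0$ for all $k$. In particular, the chain polynomial $\sum_C t^{|C|}$ ($C$ ranging over all chains, including the empty one) of $P$ is real-rooted, and so is that of the rank selected subposet $P_S=\{x\in P:\rho(x)\in S\}$ for every set $S$ of nonnegative integers. -/

import Mathlib

open Polynomial

namespace QPoset

/-! Ranks and quasi-rank uniform posets -/

/-- The quasi-rank of `x`: the largest length `k` of a chain `x₀ < x₁ < ⋯ < x_k = x`. -/
noncomputable def quasiRank {P : Type*} [PartialOrder P] (x : P) : ℕ :=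
  (Order.height x).toNat

/-- The quasi-rank of a poset, the supremum of the quasi-ranks of its elements. -/
noncomputable def posetRank (P : Type*) [PartialOrder P] : ℕ∞ :=
  ⨆ x : P, (quasiRank x : ℕ∞)

/-- The number of elements of quasi-rank `k` in the principal order ideal of `x`. -/
noncomputable def idealCount {P : Type*} [PartialOrder P] (x : P) (k : ℕ) : ℕ :=
  {z : P | z ≤ x ∧ quasiRank z = k}.ncard

/-- Quasi-rank uniform posets: locally finite, with a least element, and such that the number of
elements of quasi-rank `k` below `x` depends only on `k` and on the quasi-rank of `x`. -/
structure IsQuasiRankUniform (P : Type*) [PartialOrder P] : Prop where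
  locallyFinite : ∀ a b : P, (Set.Icc a b).Finite
  exists_bot : ∃ b : P, IsBot b
  uniform : ∀ x y : P, quasiRank x = quasiRank y → ∀ k ≤ quasiRank x,
    idealCount x k = idealCount y k

/-- The matrix `R(P) = (r_{n,k})`, where `r_{n,k}` is the number of elements of quasi-rank `k`
below any element of quasi-rank `n`. Only the rows with `n ≤ posetRank P` are meaningful. -/
noncomputable def rankMatrix (P : Type*) [PartialOrder P] (n k : ℕ) : ℝ :=
  open Classical in
  if h : ∃ x : P, quasiRank x = n then (idealCount h.choose k : ℝ) else 0

/-! Totally nonnegative and resolvable matrices `(r_{n,k})_{n,k=0}^N`, with `N ∈ ℕ ∪ {∞}` -/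

/-- All minors of `(r_{n,k})_{n,k=0}^N` are nonnegative. -/
def IsTotallyNonneg (N : ℕ∞) (R : ℕ → ℕ → ℝ) : Prop :=
  ∀ (m : ℕ) (f g : Fin m → ℕ), StrictMono f → StrictMono g →
    (∀ i, (f i : ℕ∞) ≤ N) → (∀ i, (g i : ℕ∞) ≤ N) →
    0 ≤ (Matrix.of fun i j => R (f i) (g j)).det

/-- The generating polynomial `R_n(t)` of the `n`-th row of a lower triangular matrix. -/
noncomputable def rowPoly (R : ℕ → ℕ → ℝ) (n : ℕ) : ℝ[X] :=
  ∑ k ∈ Finset.range (n + 1), C (R n k) * X ^ k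

/-- The nonnegative numbers `lam n k` and the polynomials `A n k = R_{n,k}(t)` resolve the matrix
`(r_{n,k})_{n,k=0}^N`. The last field is the normalization that makes them unique. -/
structure IsResolution (N : ℕ∞) (R : ℕ → ℕ → ℝ) (lam : ℕ → ℕ → ℝ) (A : ℕ → ℕ → ℝ[X]) : Prop where
  lam_nonneg : ∀ n k : ℕ, k ≤ n → (n : ℕ∞) < N → 0 ≤ lam n k
  monic : ∀ n k : ℕ, k ≤ n → (n : ℕ∞) ≤ N → (A n k).Monic
  first : ∀ n : ℕ, (n : ℕ∞) ≤ N → A n 0 = rowPoly R n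
  last : ∀ n : ℕ, (n : ℕ∞) ≤ N → A n n = X ^ n
  dvd : ∀ n k : ℕ, k ≤ n → (n : ℕ∞) ≤ N → X ^ k ∣ A n k
  step : ∀ n k : ℕ, k ≤ n → (n : ℕ∞) < N →
    A (n + 1) k = A (n + 1) (k + 1) + C (lam n k) * A n k
  normalized : ∀ n k : ℕ, k ≤ n → ((n + 1 : ℕ) : ℕ∞) < N → lam n k = 0 → lam (n + 1) k = 0

/-- TN-posets. -/
def IsTNPoset (P : Type*) [PartialOrder P] : Prop :=
  IsQuasiRankUniform P ∧ IsTotallyNonneg (posetRank P) (rankMatrix P)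

/-! `P`-posets and `P`-positivity -/

/-- `Q` is a `P`-poset: every principal order ideal of `Q` is isomorphic to one of `P`. -/
def IsPosetOver (P Q : Type*) [PartialOrder P] [PartialOrder Q] : Prop :=
  IsQuasiRankUniform Q ∧ ∀ x : Q, ∃ y : P, Nonempty (Set.Iic x ≃o Set.Iic y)

/-- `Q` is a combinatorial `P`-poset: the rank generating polynomial of the principal order ideal
of any `y` in `Q` is the row polynomial of `R(P)` indexed by the quasi-rank of `y`. -/
def IsCombinatorialPosetOver (P Q : Type*) [PartialOrder P] [PartialOrder Q] : Prop :=
  IsQuasiRankUniform Q ∧ ∀ y : Q,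
    ∑ᶠ x : Set.Iic y, (X : ℝ[X]) ^ quasiRank (x : Q) = rowPoly (rankMatrix P) (quasiRank y)

/-- The rank generating polynomial of a finite poset. -/
noncomputable def rankGenPoly (Q : Type*) [PartialOrder Q] [Finite Q] : ℝ[X] :=
  ∑ᶠ x : Q, X ^ quasiRank x

/-- `P`-positivity of `Q`, for a TN-poset `P`: `Q` is a combinatorial `P`-poset of rank `r`, and
its rank generating polynomial has a nonnegative expansion in the polynomials `R_{r,k}(t)`,
`0 ≤ k ≤ r`, that resolve the matrix `R(P)`. -/
structure IsPositive (P Q : Type*) [PartialOrder P] [PartialOrder Q] [Finite Q] : Prop where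
  tn : IsTNPoset P
  combinatorial : IsCombinatorialPosetOver P Q
  expansion : ∃ (lam : ℕ → ℕ → ℝ) (A : ℕ → ℕ → ℝ[X]) (r : ℕ) (h : ℕ → ℝ),
    IsResolution (posetRank P) (rankMatrix P) lam A ∧ posetRank Q = r ∧
    (∀ k ≤ r, 0 ≤ h k) ∧ rankGenPoly Q = ∑ k ∈ Finset.range (r + 1), C (h k) * A r k

/-! Subspace lattices and `q`-posets -/

/-- The poset `𝔹(q)` of all finite dimensional subspaces of `F^ℕ`, where `F` is the field with `q`
elements, ordered by inclusion. -/
abbrev SubspacePoset (F : Type*) [Field F] : Type _ :=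
  {W : Submodule F (ℕ → F) // FiniteDimensional F W}

/-- `q`-posets, where `q` is the number of elements of `F`. -/
def IsQPoset (F : Type*) [Field F] (P : Type*) [PartialOrder P] : Prop :=
  IsPosetOver (SubspacePoset F) P

/-- The polynomials `R^q_{n,k}(t) = (t + α)^{n-k} t^k`, where `(α f)(t) = f(qt)`. -/
noncomputable def qResolvent (q : ℝ) (n k : ℕ) : ℝ[X] :=
  (fun f : ℝ[X] => X * f + f.comp (C q * X))^[n - k] (X ^ k)

/-! Shellability -/

/-- `P` is a finite (nonempty) ranked poset in which all maximal elements have rank `n`. -/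
structure IsPureOfRank (P : Type*) [PartialOrder P] (n : ℕ) : Prop where
  finite : Finite P
  nonempty : Nonempty P
  ranked : ∀ x y : P, x ⋖ y → quasiRank y = quasiRank x + 1
  pure : ∀ x : P, IsMax x → quasiRank x = n

/-- `P` is pure of some rank `n` and its facets can be listed without repetition as
`F 0, …, F (m-1)` so that each `F k` with `k > 0` meets the order ideal generated by the
previous facets in a pure poset of rank `n - 1`. -/
def IsShellable (P : Type*) [PartialOrder P] : Prop :=
  ∃ n : ℕ, IsPureOfRank P n ∧ ∃ (m : ℕ) (F : Fin m ≃ {x : P // IsMax x}),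
    ∀ k : Fin m, 0 < (k : ℕ) → ∃ d : ℕ, d + 1 = n ∧
      IsPureOfRank {x : P // (∃ i < k, x ≤ (F i : P)) ∧ x ≤ (F k : P)} d

/-! Chain polynomials -/

/-- The chain polynomial `∑ t^|C|` of a finite poset, summed over all chains `C`, including the
empty one. -/
noncomputable def chainPoly (Q : Type*) [PartialOrder Q] [Finite Q] : ℝ[X] :=
  ∑ᶠ D : {D : Set Q // IsChain (· ≤ ·) D}, X ^ (D : Set Q).ncard

/-- The rank selected subposet of `P` given by a set `S` of ranks. -/
abbrev RankSelected (P : Type*) [PartialOrder P] (S : Set ℕ) : Type _ :=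
  {x : P // quasiRank x ∈ S}

end QPoset

/-! Let q = |F| and R_{n,k} = (t + α)^{n-k} t^k. Then R_{n+1,k} = R_{n+1,k+1} + q^k R_{n,k}, and
R_{n,0} is the rank generating polynomial of the subspaces of an n-dimensional space. Each R_{n,k}
begins with a nonzero multiple of t^k, so expansions are unique; the q-Pascal recursion factors the
matrix of coefficients and makes it totally nonnegative.

Positivity: assign each element of P to the first facet above it. By shellability, the elements
assigned to one facet correspond to the subspaces of an n-dimensional space that lie in no member of
a set H of hyperplanes. For such an arrangement (`exists_nonneg_expansion`), counting pairs W ≤ D ⋖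
E writes every coefficient except the top one as a positive multiple of the sum of the corresponding
coefficients for the hyperplanes D of E. The top coefficient is treated by adding the members of H
one at a time.

Real-rootedness: the number of chains with a given greatest element depends only on its rank, so the
chain polynomial of P_S at z equals Φ(f_P) for a linear functional Φ. For Im z > 0, induction on n
shows that Φ(R_{n,j}) times the conjugate of Φ(R_{n,i}), i ≤ j, lies in the cone spanned by 1 and u
= z/(1+z) (`inCone_functional`); this is interlacing read at a point of the upper half plane. Since
Im u > 0, Φ(R_{n,0}) ≠ 0, h_0 = 1 and all h_k ≥ 0, the sum of the h_k Φ(R_{n,k}) cannot vanish. -/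

namespace QPoset

/-! ### The polynomials R^q_{n,k} -/

section Resolvent

variable (q : ℝ)

/-- The operator `t + α`, where `(α f)(t) = f(qt)`. -/
noncomputable def qRaise : ℝ[X] →ₗ[ℝ] ℝ[X] where
  toFun f := X * f + f.comp (C q * X)
  map_add' f g := by simp only [add_comp]; ring
  map_smul' c f := by simp [smul_comp, smul_add]

theorem qResolvent_eq (n k : ℕ) : qResolvent q n k = (qRaise q)^[n - k] (X ^ k) := rfl

@[simp] theorem qResolvent_self (n : ℕ) : qResolvent q n n = X ^ n := by
  simp [qResolvent]

theorem qResolvent_succ {n k : ℕ} (h : k ≤ n) :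
    qResolvent q (n + 1) k = qRaise q (qResolvent q n k) := by
  rw [qResolvent_eq, qResolvent_eq, Nat.succ_sub h, Function.iterate_succ_apply']

theorem qRaise_X_pow (k : ℕ) : qRaise q (X ^ k) = X ^ (k + 1) + C (q ^ k) * X ^ k := by
  simp [qRaise, mul_pow, pow_succ']

/-- The case n = k is (t + α) t^k = t^{k+1} + q^k t^k; applying the linear operator t + α repeatedly
gives the others. -/
theorem qResolvent_step {n k : ℕ} (h : k ≤ n) :
    qResolvent q (n + 1) k = qResolvent q (n + 1) (k + 1) + C (q ^ k) * qResolvent q n k := by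
  induction n, h using Nat.le_induction with
  | base => rw [qResolvent_succ q le_rfl, qResolvent_self, qResolvent_self, qRaise_X_pow]
  | succ n h ih =>
    rw [qResolvent_succ q (show k ≤ n + 1 by omega), ih, map_add, ← smul_eq_C_mul, map_smul,
      ← qResolvent_succ q (by omega), ← qResolvent_succ q h, smul_eq_C_mul, smul_eq_C_mul, ← ih]

theorem coeff_qRaise_zero (f : ℝ[X]) : (qRaise q f).coeff 0 = f.coeff 0 := by
  simp [qRaise]

theorem coeff_qRaise_succ (f : ℝ[X]) (j : ℕ) :
    (qRaise q f).coeff (j + 1) = f.coeff j + q ^ (j + 1) * f.coeff (j + 1) := by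
  simp [qRaise, coeff_X_mul, comp_C_mul_X_coeff, mul_comm (q ^ (j + 1))]

theorem coeff_qResolvent_of_gt {n k j : ℕ} (h : k ≤ n) (hj : n < j) :
    (qResolvent q n k).coeff j = 0 := by
  induction n, h using Nat.le_induction generalizing j with
  | base => simp [coeff_X_pow, hj.ne']
  | succ n h ih =>
    obtain ⟨i, rfl⟩ : ∃ i, j = i + 1 := ⟨j - 1, by omega⟩
    rw [qResolvent_succ q h, coeff_qRaise_succ, ih (by omega), ih (by omega)]; simp

theorem coeff_qResolvent_top {n k : ℕ} (h : k ≤ n) : (qResolvent q n k).coeff n = 1 := by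
  induction n, h using Nat.le_induction with
  | base => simp
  | succ n h ih =>
    rw [qResolvent_succ q h, coeff_qRaise_succ, ih, coeff_qResolvent_of_gt q h (by omega)]; simp

theorem monic_qResolvent {n k : ℕ} (h : k ≤ n) : (qResolvent q n k).Monic :=
  monic_of_natDegree_le_of_coeff_eq_one n
    (natDegree_le_iff_coeff_eq_zero.2 fun _ hj => coeff_qResolvent_of_gt q h hj)
    (coeff_qResolvent_top q h)

theorem coeff_qResolvent_of_lt {n k j : ℕ} (h : k ≤ n) (hj : j < k) :
    (qResolvent q n k).coeff j = 0 := by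
  induction n, h using Nat.le_induction generalizing j with
  | base => simp [coeff_X_pow, hj.ne]
  | succ n h ih =>
    rw [qResolvent_succ q h]
    cases j with
    | zero => rw [coeff_qRaise_zero, ih hj]
    | succ j => rw [coeff_qRaise_succ, ih (by omega), ih hj]; simp

theorem X_pow_dvd_qResolvent {n k : ℕ} (h : k ≤ n) : X ^ k ∣ qResolvent q n k :=
  X_pow_dvd_iff.2 fun _ hj => coeff_qResolvent_of_lt q h hj

theorem coeff_qResolvent_bot {n k : ℕ} (h : k ≤ n) :
    (qResolvent q n k).coeff k = q ^ (k * (n - k)) := by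
  induction n, h using Nat.le_induction with
  | base => simp
  | succ n h ih =>
    rw [qResolvent_succ q h]
    cases k with
    | zero => rw [coeff_qRaise_zero, ih]; simp
    | succ k =>
      rw [coeff_qRaise_succ, ih, coeff_qResolvent_of_lt q h (by omega), ← pow_add, Nat.succ_sub h,
        zero_add, Nat.succ_eq_add_one]
      congr 1
      ring

/-- In operator form, (q^{n+1} - α) R_{n+1,k} = (q^{n+1} - q^k) α R_{n,k}. This is the algebraic
counterpart of the count of pairs W ≤ D ⋖ E in `sum_covBy_coeff`, and lets that count be compared
coefficient by coefficient. -/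
theorem coeff_qResolvent_lower {n k : ℕ} (h : k ≤ n) (j : ℕ) :
    (q ^ (n + 1) - q ^ j) * (qResolvent q (n + 1) k).coeff j =
      (q ^ (n + 1) - q ^ k) * (q ^ j * (qResolvent q n k).coeff j) := by
  induction n, h using Nat.le_induction generalizing j with
  | base =>
    rw [qResolvent_succ q le_rfl, qResolvent_self]
    cases j with
    | zero =>
      rw [coeff_qRaise_zero, coeff_X_pow]
      rcases Nat.eq_zero_or_pos k with rfl | h
      · simp
      · simp [h.ne]
    | succ j =>
      rw [coeff_qRaise_succ, coeff_X_pow, coeff_X_pow]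
      split_ifs with h1 h2 h2
      · omega
      · subst h1; simp
      · subst h2; simp
      · simp
  | succ n h ih =>
    rw [qResolvent_succ q (show k ≤ n + 1 by omega)]
    cases j with
    | zero =>
      have := ih 0
      rw [coeff_qRaise_zero]
      rw [qResolvent_succ q h, coeff_qRaise_zero] at this ⊢
      linear_combination this
    | succ j =>
      rw [coeff_qRaise_succ]
      have h1 := ih j
      have h2 := ih (j + 1)
      have h3 : (qResolvent q (n + 1) k).coeff (j + 1) =
          (qResolvent q n k).coeff j + q ^ (j + 1) * (qResolvent q n k).coeff (j + 1) := by
        rw [qResolvent_succ q h, coeff_qRaise_succ]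
      linear_combination q * h1 + q ^ (j + 1) * h2 - q ^ (j + 1) * (q ^ (n + 1) - q ^ k) * h3

/-- The system is triangular: R_{n,k} has no terms below t^k, and its coefficient at t^k is a power
of q. -/
theorem qResolvent_coeffs_unique (hq : q ≠ 0) {n : ℕ} {a : ℕ → ℝ}
    (h : ∀ j ≤ n, ∑ k ∈ Finset.range (n + 1), a k * (qResolvent q n k).coeff j = 0) :
    ∀ k ≤ n, a k = 0 := by
  intro k
  induction k using Nat.strong_induction_on with
  | _ k ih =>
    intro hk
    have := h k hk
    rw [Finset.sum_eq_single k] at this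
    · rw [coeff_qResolvent_bot q hk] at this
      exact (mul_eq_zero.1 this).resolve_right (pow_ne_zero _ hq)
    · intro i hi hne
      have hi' : i ≤ n := by simpa [Nat.lt_succ_iff] using hi
      rcases lt_or_gt_of_ne hne with hlt | hgt
      · rw [ih i hlt hi', zero_mul]
      · rw [coeff_qResolvent_of_lt q hi' hgt, mul_zero]
    · intro hk'; exact absurd (Finset.mem_range.2 (by omega)) hk'

theorem coeff_sum_qResolvent (m n : ℕ) (a : ℕ → ℝ) (j : ℕ) :
    (∑ k ∈ Finset.range m, C (a k) * qResolvent q n k).coeff j =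
      ∑ k ∈ Finset.range m, a k * (qResolvent q n k).coeff j := by
  simp

end Resolvent

/-! ### Avoiding hyperplanes in a subspace lattice -/

section Modular

open scoped Classical in
/-- The generating polynomial of the elements below `E` that lie below no element of `H`. -/
noncomputable def avoidPoly {L : Type*} [Lattice L] [Fintype L] (r : L → ℕ) (E : L)
    (H : Finset L) : ℝ[X] :=
  ∑ W with W ≤ E ∧ ∀ G ∈ H, ¬ W ≤ G, X ^ r W

section

variable {L : Type*} [Lattice L] [Fintype L] {r : L → ℕ}

open scoped Classical in
theorem coeff_avoidPoly (E : L) (H : Finset L) (j : ℕ) :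
    (avoidPoly r E H).coeff j =
      (({W : L | (W ≤ E ∧ ∀ G ∈ H, ¬ W ≤ G) ∧ r W = j} : Finset L).card : ℝ) := by
  simp only [avoidPoly, finsetSum_coeff, coeff_X_pow, Finset.sum_boole, Finset.filter_filter]
  simp [eq_comm]

theorem avoidPoly_eq_zero {E G : L} {H : Finset L} (hG : G ∈ H) (h : E ≤ G) :
    avoidPoly r E H = 0 := by
  classical
  rw [avoidPoly, Finset.filter_eq_empty_iff.2, Finset.sum_empty]
  rintro W - ⟨h1, h2⟩
  exact h2 G hG (h1.trans h)

open scoped Classical in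
theorem avoidPoly_insert (E G : L) (H : Finset L) :
    avoidPoly r E (insert G H) = avoidPoly r E H - avoidPoly r (G ⊓ E) H := by
  rw [eq_sub_iff_add_eq, avoidPoly, avoidPoly, avoidPoly, ← Finset.sum_union]
  · congr 1
    ext W
    simp only [Finset.mem_union, Finset.mem_filter, Finset.mem_univ, true_and,
      Finset.forall_mem_insert, le_inf_iff]
    tauto
  · rw [Finset.disjoint_filter]
    rintro W - ⟨h1, h2⟩ ⟨h3, h4⟩
    exact h2 G (Finset.mem_insert_self _ _) (h3.trans inf_le_left)

end

/-- A finite modular lattice with a rank function, in which the number of elements covered by `E`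
and above `W` is `(q^m - 1)/(q - 1)`, where `m` is the difference of the ranks. -/
structure IsSubspaceLattice {L : Type*} [Lattice L] [BoundedOrder L] [Fintype L] (q : ℝ)
    (r : L → ℕ) : Prop where
  one_lt : 1 < q
  modular : IsModularLattice L
  rank_bot : r ⊥ = 0
  rank_covBy : ∀ a b : L, a ⋖ b → r b = r a + 1
  card_coatoms : ∀ W E : L, W ≤ E →
    (q - 1) * (Nat.card {D : L // W ≤ D ∧ D ⋖ E} : ℝ) = q ^ (r E - r W) - 1

variable {L : Type*} [Lattice L] [BoundedOrder L] [Fintype L] {q : ℝ} {r : L → ℕ}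

theorem IsSubspaceLattice.rank_lt (h : IsSubspaceLattice q r) {a b : L} (hab : a < b) :
    r a < r b := by
  induction b using WellFoundedLT.induction with
  | _ b ih =>
    obtain ⟨c, hac, hcb⟩ := exists_le_covBy_of_lt hab
    have := h.rank_covBy c b hcb
    rcases hac.eq_or_lt with rfl | hlt
    · omega
    · have := ih c hcb.lt hlt; omega

theorem IsSubspaceLattice.rank_le (h : IsSubspaceLattice q r) {a b : L} (hab : a ≤ b) :
    r a ≤ r b := by
  rcases hab.eq_or_lt with rfl | hlt
  · exact le_rfl
  · exact (h.rank_lt hlt).le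

theorem IsSubspaceLattice.eq_of_le (h : IsSubspaceLattice q r) {a b : L} (hab : a ≤ b)
    (hr : r a = r b) : a = b := by
  rcases hab.eq_or_lt with rfl | hlt
  · rfl
  · have := h.rank_lt hlt; omega

theorem IsSubspaceLattice.coeff_avoidPoly_of_gt (h : IsSubspaceLattice q r) {E : L} {H : Finset L}
    {j : ℕ} (hj : r E < j) : (avoidPoly r E H).coeff j = 0 := by
  classical
  rw [coeff_avoidPoly, Finset.filter_eq_empty_iff.2]
  · simp
  · rintro W - ⟨⟨h1, -⟩, h2⟩
    have := h.rank_le h1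
    omega

open scoped Classical in
/-- Counting pairs `W ≤ D ⋖ E`. -/
theorem IsSubspaceLattice.sum_covBy_coeff (h : IsSubspaceLattice q r) (E : L) (H : Finset L)
    (j : ℕ) :
    (q - 1) * ∑ D with D ⋖ E, (avoidPoly r D H).coeff j =
      (q ^ (r E - j) - 1) * (avoidPoly r E H).coeff j := by
  have key : ∑ D with D ⋖ E, (avoidPoly r D H).coeff j =
      ∑ W with (W ≤ E ∧ ∀ G ∈ H, ¬ W ≤ G) ∧ r W = j,
        (Nat.card {D : L // W ≤ D ∧ D ⋖ E} : ℝ) := by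
    have := Finset.sum_card_bipartiteAbove_eq_sum_card_bipartiteBelow (fun D W : L => W ≤ D)
      (s := ({D | D ⋖ E} : Finset L))
      (t := ({W | (W ≤ E ∧ ∀ G ∈ H, ¬ W ≤ G) ∧ r W = j} : Finset L))
    rw [← Nat.cast_inj (R := ℝ), Nat.cast_sum, Nat.cast_sum] at this
    convert this using 2 with D hD W hW
    · rw [coeff_avoidPoly, Finset.bipartiteAbove, Finset.filter_filter]
      congr 2
      ext W
      have hD' : D ⋖ E := by simpa using hD
      have := fun h : W ≤ D => h.trans hD'.le
      simp only [Finset.mem_filter, Finset.mem_univ, true_and]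
      tauto
    · rw [Finset.bipartiteBelow, Finset.filter_filter, Nat.card_eq_fintype_card,
        Fintype.card_subtype]
      simp only [and_comm]
  rw [key, Finset.mul_sum, coeff_avoidPoly, mul_comm, ← nsmul_eq_mul, ← Finset.sum_const]
  refine Finset.sum_congr rfl fun W hW => ?_
  simp only [Finset.mem_filter, Finset.mem_univ, true_and] at hW
  rw [h.card_coatoms W E hW.1.1, hW.2]

theorem IsSubspaceLattice.coeff_avoidPoly_top (h : IsSubspaceLattice q r) (E : L) :
    (avoidPoly r E ∅).coeff (r E) = 1 := by
  classical
  rw [coeff_avoidPoly, Nat.cast_eq_one, Finset.card_eq_one]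
  refine ⟨E, ?_⟩
  ext W
  simp only [Finset.notMem_empty, false_imp_iff, implies_true, and_true, Finset.mem_filter,
    Finset.mem_univ, true_and, Finset.mem_singleton]
  exact ⟨fun hW => h.eq_of_le hW.1 hW.2, by rintro rfl; simp⟩

/-- The rank generating polynomial of a subspace lattice. -/
theorem IsSubspaceLattice.avoidPoly_empty (h : IsSubspaceLattice q r) (E : L) :
    avoidPoly r E ∅ = qResolvent q (r E) 0 := by
  classical
  have hq := h.one_lt
  obtain ⟨n, hn⟩ : ∃ n, r E = n := ⟨_, rfl⟩
  rw [hn]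
  induction n generalizing E with
  | zero =>
    ext j
    cases j with
    | zero => rw [← hn, h.coeff_avoidPoly_top, hn]; simp
    | succ j =>
      rw [h.coeff_avoidPoly_of_gt (by omega), coeff_qResolvent_of_gt q le_rfl (by omega)]
  | succ n ih =>
    ext j
    rcases lt_trichotomy j (n + 1) with hj | rfl | hj
    · have h1 := h.sum_covBy_coeff E ∅ j
      have h2 : ∑ D with D ⋖ E, (avoidPoly r D ∅).coeff j =
          ∑ D with D ⋖ E, (qResolvent q n 0).coeff j := by
        refine Finset.sum_congr rfl fun D hD => ?_
        have := h.rank_covBy D E (by simpa using hD)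
        rw [ih D (by omega)]
      -- There are (q^{n+1} - 1)/(q - 1) terms, all equal, so the pair count becomes the lowering
      -- identity with k = 0.
      have h3 := h.card_coatoms ⊥ E bot_le
      simp only [bot_le, true_and, Nat.card_eq_fintype_card, Fintype.card_subtype] at h3
      rw [h2, Finset.sum_const, nsmul_eq_mul, ← mul_assoc, h3, hn, h.rank_bot] at h1
      have h4 := coeff_qResolvent_lower q (Nat.zero_le n) j
      have h5 : q ^ (n + 1) = q ^ (n + 1 - j) * q ^ j := by rw [← pow_add]; congr 1; omega
      have h6 : q ^ (n + 1) - q ^ j ≠ 0 := sub_ne_zero.2 (pow_lt_pow_right₀ hq hj).ne'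
      refine mul_left_cancel₀ h6 ?_
      rw [h4]
      rw [Nat.sub_zero] at h1
      linear_combination (-q ^ j) * h1 + (avoidPoly r E ∅).coeff j * h5
    · rw [← hn, h.coeff_avoidPoly_top, hn, coeff_qResolvent_top q (Nat.zero_le _)]
    · rw [h.coeff_avoidPoly_of_gt (by omega), coeff_qResolvent_of_gt q (by omega) hj]

/-- Makes the hypothesis on H hereditary. If D and G ⊓ E are distinct coatoms of E, their join is E,
and modularity gives that their meet is covered by D. The alternative D ≤ G has to be allowed, since
restricting to D may swallow D. -/
theorem IsSubspaceLattice.meets_of_covBy (h : IsSubspaceLattice q r) {E D G : L} (hD : D ⋖ E)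
    (hG : E ≤ G ∨ G ⊓ E ⋖ E) : D ≤ G ∨ G ⊓ D ⋖ D := by
  have := h.modular
  rcases hG with hG | hG
  · exact Or.inl (hD.le.trans hG)
  by_cases hDG : D ≤ G
  · exact Or.inl hDG
  refine Or.inr ?_
  have hne : D ≠ G ⊓ E := fun e => hDG (e ▸ inf_le_left)
  have hsup : D ⊔ (G ⊓ E) = E := by
    refine (hD.eq_or_eq le_sup_left (sup_le hD.le hG.le)).resolve_left fun e => ?_
    rcases hG.eq_or_eq (sup_eq_left.1 e) hD.le with h1 | h1
    · exact hne h1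
    · exact hD.ne h1
  have h1 : D ⊓ (G ⊓ E) ⋖ D := inf_covBy_of_covBy_sup_right (hsup.symm ▸ hG)
  rwa [show G ⊓ D = D ⊓ (G ⊓ E) by
    rw [← inf_assoc, inf_comm D G, inf_assoc, inf_eq_left.2 hD.le]]

/-- The elements below `E` that avoid a set of elements covered by `E` have a generating
polynomial with a nonnegative expansion in the polynomials `R^q_{n,k}`. -/
theorem IsSubspaceLattice.exists_nonneg_expansion (h : IsSubspaceLattice q r) (E : L)
    (H : Finset L) (hH : ∀ G ∈ H, E ≤ G ∨ G ⊓ E ⋖ E) :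
    ∃ a : ℕ → ℝ, (∀ k ≤ r E, 0 ≤ a k) ∧
      avoidPoly r E H = ∑ k ∈ Finset.range (r E + 1), C (a k) * qResolvent q (r E) k := by
  classical
  have hq := h.one_lt
  have hq0 : q ≠ 0 := by linarith
  obtain ⟨n, hn⟩ : ∃ n, r E = n := ⟨_, rfl⟩
  rw [hn]
  induction n generalizing E H with
  | zero =>
    by_cases hE : ∃ G ∈ H, E ≤ G
    · obtain ⟨G, hG, hEG⟩ := hE
      exact ⟨0, by simp, by simp [avoidPoly_eq_zero hG hEG]⟩
    · push Not at hE
      have : H = ∅ := by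
        refine Finset.eq_empty_of_forall_notMem fun G hG => ?_
        rcases hH G hG with h1 | h1
        · exact hE G hG h1
        · have := h.rank_covBy _ _ h1; omega
      subst this
      exact ⟨1, by simp, by simp [h.avoidPoly_empty, hn]⟩
  | succ n ih =>
    -- The double count below carries the factor q^{n+1} - q^k, which vanishes at k = n + 1; the
    -- sign of the top coefficient is therefore obtained separately, by building up H.
    have exp : ∃ a : ℕ → ℝ, 0 ≤ a (n + 1) ∧
        avoidPoly r E H = ∑ k ∈ Finset.range (n + 2), C (a k) * qResolvent q (n + 1) k := by
      have key : ∀ H' ⊆ H, ∃ a : ℕ → ℝ, 0 ≤ a (n + 1) ∧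
        avoidPoly r E H' = ∑ k ∈ Finset.range (n + 2), C (a k) * qResolvent q (n + 1) k := by
        intro H'
        induction H' using Finset.induction_on with
        | empty =>
          intro _
          refine ⟨fun k => if k = 0 then 1 else 0, by simp, ?_⟩
          rw [h.avoidPoly_empty, hn, Finset.sum_eq_single 0] <;> simp +contextual
        | insert G H' hGH ih' =>
          intro hsub
          obtain ⟨a, ha, hsum⟩ := ih' ((Finset.subset_insert _ _).trans hsub)
          rcases hH G (hsub (Finset.mem_insert_self _ _)) with hG | hG
          · exact ⟨0, by simp, by simp [avoidPoly_eq_zero (Finset.mem_insert_self G H') hG]⟩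
          have hrk := h.rank_covBy _ _ hG
          obtain ⟨b, hb, hbsum⟩ := ih (G ⊓ E) H' (fun G' hG' =>
            h.meets_of_covBy hG (hH G' (hsub (Finset.mem_insert_of_mem hG')))) (by omega)
          -- Since R_{n,k} = q^{-k}(R_{n+1,k} - R_{n+1,k+1}), subtracting b_k R_{n,k} lowers the
          -- coefficient at k and raises the one at k + 1 by q^{-k} b_k. The index n + 1 is only
          -- ever raised.
          refine ⟨fun k => a k - (if k ≤ n then (q ^ k)⁻¹ * b k else 0) +
            (if 1 ≤ k then (q ^ (k - 1))⁻¹ * b (k - 1) else 0), ?_, ?_⟩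
          · have := hb n le_rfl
            have : 0 ≤ q := by linarith
            simp only [Nat.not_succ_le_self, if_false, Nat.le_add_left, if_true,
              Nat.add_sub_cancel]
            positivity
          · rw [avoidPoly_insert, hsum, hbsum]
            simp only [map_add, map_sub, add_mul, sub_mul, Finset.sum_add_distrib,
              Finset.sum_sub_distrib]
            rw [sub_add, sub_right_inj, Finset.sum_range_succ _ (n + 1),
              Finset.sum_range_succ' _ (n + 1)]
            simp only [Nat.not_succ_le_self, if_false, map_zero, zero_mul, add_zero,
              Nat.le_add_left, if_true, Nat.add_sub_cancel,
              nonpos_iff_eq_zero, one_ne_zero]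
            rw [← Finset.sum_sub_distrib]
            refine Finset.sum_congr rfl fun k hk => ?_
            have hk : k ≤ n := by simpa [Nat.lt_succ_iff] using hk
            rw [if_pos hk, ← mul_sub, qResolvent_step q hk, add_sub_cancel_left, ← mul_assoc,
              ← C_mul, mul_right_comm, inv_mul_cancel₀ (pow_ne_zero k hq0), one_mul]
      exact key H subset_rfl
    obtain ⟨a, ha, hsum⟩ := exp
    refine ⟨a, fun k hk => ?_, hsum⟩
    rcases hk.eq_or_lt with rfl | hk
    · exact ha
    have hex : ∀ D : L, ∃ b : ℕ → ℝ, D ⋖ E → (∀ k ≤ n, 0 ≤ b k) ∧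
        avoidPoly r D H = ∑ k ∈ Finset.range (n + 1), C (b k) * qResolvent q n k := by
      intro D
      by_cases hD : D ⋖ E
      · have := h.rank_covBy D E hD
        obtain ⟨b, hb⟩ := ih D H (fun G hG => h.meets_of_covBy hD (hH G hG)) (by omega)
        exact ⟨b, fun _ => hb⟩
      · exact ⟨0, fun h => absurd h hD⟩
    choose b hb using hex
    -- Comparing the pair count with the lowering identity in degrees j ≤ n, where the term t^{n+1}
    -- is invisible, gives (q - 1) ∑_D b_{D,k} = a_k (q^{n+1} - q^k).
    have main := qResolvent_coeffs_unique q hq0 (n := n)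
      (a := fun k => (q - 1) * ∑ D with D ⋖ E, b D k - a k * (q ^ (n + 1) - q ^ k)) (by
        intro j hj
        have h1 := h.sum_covBy_coeff E H j
        rw [hsum, hn, coeff_sum_qResolvent, Finset.sum_range_succ, qResolvent_self, coeff_X_pow,
          if_neg (by omega), mul_zero, add_zero] at h1
        have h2 : ∑ D with D ⋖ E, (avoidPoly r D H).coeff j =
            ∑ k ∈ Finset.range (n + 1), (∑ D with D ⋖ E, b D k) * (qResolvent q n k).coeff j := by
          simp only [Finset.sum_mul]
          rw [Finset.sum_comm]
          refine Finset.sum_congr rfl fun D hD => ?_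
          rw [(hb D (by simpa using hD)).2, coeff_sum_qResolvent]
        rw [h2] at h1
        have h5 : q ^ (n + 1) = q ^ (n + 1 - j) * q ^ j := by rw [← pow_add]; congr 1; omega
        have h3 : q ^ j * ((q ^ (n + 1 - j) - 1) *
              ∑ k ∈ Finset.range (n + 1), a k * (qResolvent q (n + 1) k).coeff j) =
            q ^ j * ∑ k ∈ Finset.range (n + 1),
              a k * ((q ^ (n + 1) - q ^ k) * (qResolvent q n k).coeff j) := by
          rw [← mul_assoc, Finset.mul_sum, Finset.mul_sum]
          refine Finset.sum_congr rfl fun k hk => ?_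
          have := coeff_qResolvent_lower q (show k ≤ n by simpa [Nat.lt_succ_iff] using hk) j
          linear_combination a k * this - a k * (qResolvent q (n + 1) k).coeff j * h5
        rw [← h1] at h3
        have h4 := mul_left_cancel₀ (pow_ne_zero j hq0) h3
        simp only [sub_mul, Finset.sum_sub_distrib, mul_assoc] at h4 ⊢
        simp only [← Finset.mul_sum, Finset.sum_sub_distrib, mul_sub] at h4 ⊢
        linarith)
    have hk' := main k (by omega)
    have hpos : 0 < q ^ (n + 1) - q ^ k := sub_pos.2 (pow_lt_pow_right₀ hq hk)
    have hnn : 0 ≤ a k * (q ^ (n + 1) - q ^ k) := by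
      rw [← sub_eq_zero.1 hk']
      refine mul_nonneg (by linarith) (Finset.sum_nonneg fun D hD => ?_)
      exact (hb D (by simpa using hD)).1 k (by omega)
    exact nonneg_of_mul_nonneg_left hnn hpos

end Modular

/-! ### Counting hyperplanes -/

section Subspaces

open Module

variable {F V : Type*} [Field F] [AddCommGroup V] [Module F V]

theorem height_submodule_eq_finrank (W : Submodule F V) [FiniteDimensional F W] :
    Order.height W = finrank F W := by
  rw [← Module.length_submodule, Module.length_eq_finrank]

theorem finrank_of_covBy [FiniteDimensional F V] {A B : Submodule F V} (h : A ⋖ B) :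
    finrank F B = finrank F A + 1 := by
  have h1 := (covBy_iff_quot_is_simple h.le).1 h
  rw [isSimpleModule_iff_finrank_eq_one] at h1
  have h2 := Submodule.finrank_quotient_add_finrank (A.comap B.subtype)
  have h3 := (Submodule.comapSubtypeEquivOfLe h.le).finrank_eq
  omega

/-- Hyperplanes correspond, by taking annihilators, to lines in the dual space, that is, to points
of a projective space. -/
theorem card_isCoatom_submodule [Finite F] [FiniteDimensional F V] :
    (Nat.card F - 1) * Nat.card {D : Submodule F V // IsCoatom D} + 1 =
      Nat.card F ^ finrank F V := by
  have e1 : {D : Submodule F V // IsCoatom D} ≃ {A : Submodule F (Dual F V) // finrank F A = 1} :=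
    ((Subspace.orderIsoFiniteDimensional (K := F) (V := V)).toEquiv.trans
      OrderDual.ofDual).subtypeEquiv fun D => by
        rw [← Submodule.isAtom_iff_finrank_eq_one, ← isCoatom_dual_iff_isAtom]
        exact (OrderIso.isCoatom_iff (Subspace.orderIsoFiniteDimensional (K := F) (V := V)) D).symm
  have : Finite (Dual F V) := Module.finite_of_finite F
  rw [Nat.card_congr (e1.trans (Projectivization.equivSubmodule F (Dual F V)).symm), mul_comm,
    ← Projectivization.card' F (Dual F V), Module.natCard_eq_pow_finrank (K := F),
    Subspace.dual_finrank_eq]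

/-- Hyperplanes of E that contain W are hyperplanes of the quotient E/W. -/
theorem card_covBy_submodule [Finite F] [FiniteDimensional F V] {W E : Submodule F V} (h : W ≤ E) :
    (Nat.card F - 1) * Nat.card {D : Submodule F V // W ≤ D ∧ D ⋖ E} + 1 =
      Nat.card F ^ (finrank F E - finrank F W) := by
  set W' := W.comap E.subtype
  have e1 : {D : Submodule F (E ⧸ W') // IsCoatom D} ≃ {D : Set.Ici W' // IsCoatom D} :=
    (Submodule.comapMkQRelIso W').toEquiv.subtypeEquiv fun D =>
      (OrderIso.isCoatom_iff (Submodule.comapMkQRelIso W') D).symm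
  have hIci : ∀ D : Set.Ici W', IsCoatom D ↔ IsCoatom (D : Submodule F E) := fun D => by
    refine ⟨fun h => ⟨fun e => h.1 (Subtype.ext e), fun B hB => ?_⟩,
      fun h => ⟨fun e => h.1 (congrArg Subtype.val e), fun B hB => Subtype.ext (h.2 B hB)⟩⟩
    exact congrArg Subtype.val (h.2 ⟨B, le_trans D.2 hB.le⟩ hB)
  have e2 : {D : Set.Ici W' // IsCoatom D} ≃ {D : Submodule F E // W' ≤ D ∧ IsCoatom D} :=
    { toFun := fun D => ⟨D.1.1, D.1.2, (hIci D.1).1 D.2⟩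
      invFun := fun D => ⟨⟨D.1, D.2.1⟩, (hIci ⟨D.1, D.2.1⟩).2 D.2.2⟩
      left_inv := fun D => rfl
      right_inv := fun D => rfl }
  have e3 : {D : Submodule F E // W' ≤ D ∧ IsCoatom D} ≃
      {D : Set.Iic E // W ≤ (D : Submodule F V) ∧ IsCoatom D} :=
    (Submodule.mapIic E).toEquiv.subtypeEquiv fun D => by
      refine and_congr ?_ (OrderIso.isCoatom_iff (Submodule.mapIic E) D).symm
      have hW : W'.map E.subtype = W := by
        rw [Submodule.map_comap_eq, Submodule.range_subtype, inf_eq_right.2 h]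
      change W' ≤ D ↔ W ≤ D.map E.subtype
      rw [← hW, Submodule.map_le_map_iff_of_injective E.injective_subtype]
  have e4 : {D : Set.Iic E // W ≤ (D : Submodule F V) ∧ IsCoatom D} ≃
      {D : Submodule F V // W ≤ D ∧ D ⋖ E} :=
    { toFun := fun D => ⟨D.1.1, D.2.1, Set.Iic.isCoatom_iff.1 D.2.2⟩
      invFun := fun D => ⟨⟨D.1, D.2.2.le⟩, D.2.1, Set.Iic.isCoatom_iff.2 D.2.2⟩
      left_inv := fun D => rfl
      right_inv := fun D => rfl }
  rw [← Nat.card_congr (((e1.trans e2).trans e3).trans e4), card_isCoatom_submodule]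
  have h2 := Submodule.finrank_quotient_add_finrank W'
  have h3 : finrank F W' = finrank F W := (Submodule.comapSubtypeEquivOfLe h).finrank_eq
  congr 1
  omega

theorem isSubspaceLattice_submodule [Finite F] [FiniteDimensional F V] [Fintype (Submodule F V)] :
    IsSubspaceLattice (L := Submodule F V) (Nat.card F : ℝ) (fun W => finrank F W) where
  one_lt := by exact_mod_cast Finite.one_lt_card (α := F)
  modular := inferInstance
  rank_bot := finrank_bot F V
  rank_covBy _ _ h := finrank_of_covBy h
  card_coatoms W E h := by
    have h1 := card_covBy_submodule h
    have h2 : 1 ≤ Nat.card F := (Finite.one_lt_card (α := F)).le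
    rw [← Nat.cast_inj (R := ℝ)] at h1
    push_cast [h2] at h1
    linarith

end Subspaces

/-! ### Principal ideals that are subspace lattices -/

section Ideals

open Module

theorem height_subtype_of_lower {P : Type*} [PartialOrder P] {p : P → Prop}
    (hp : ∀ x y, x ≤ y → p y → p x) (z : {x // p x}) :
    Order.height z = Order.height (z : P) := by
  rw [← WithBot.coe_inj, Order.height_eq_krullDim_Iic, Order.height_eq_krullDim_Iic]
  refine Order.krullDim_eq_of_orderIso
    { toFun := fun y => ⟨y.1.1, y.2⟩
      invFun := fun y => ⟨⟨y.1, hp _ _ y.2 z.2⟩, y.2⟩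
      left_inv := fun _ => rfl
      right_inv := fun _ => rfl
      map_rel_iff' := Iff.rfl }

theorem quasiRank_subtype_of_lower {P : Type*} [PartialOrder P] {p : P → Prop}
    (hp : ∀ x y, x ≤ y → p y → p x) (z : {x // p x}) : quasiRank z = quasiRank (z : P) := by
  rw [quasiRank, quasiRank, height_subtype_of_lower hp]

/-- Every principal order ideal is the lattice of subspaces of a finite dimensional space. -/
def HasSubspaceIdeals (F : Type*) [Field F] (P : Type*) [PartialOrder P] : Prop :=
  ∀ x : P, ∃ W : Submodule F (ℕ → F), FiniteDimensional F W ∧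
    Nonempty (Set.Iic x ≃o Submodule F W)

/-- The ideal of `W` in `𝔹(q)` is the lattice of subspaces of `W`. -/
noncomputable def subspacePosetIic {F : Type*} [Field F] (W : SubspacePoset F) :
    Set.Iic W ≃o Submodule F W.1 :=
  have := W.2
  OrderIso.trans
    { toFun := fun y => ⟨y.1.1, y.2⟩
      invFun := fun y => ⟨⟨y.1, Submodule.finiteDimensional_of_le y.2⟩, y.2⟩
      left_inv := fun _ => rfl
      right_inv := fun _ => rfl
      map_rel_iff' := Iff.rfl } (Submodule.mapIic W.1).symm

theorem hasSubspaceIdeals_subspacePoset (F : Type*) [Field F] :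
    HasSubspaceIdeals F (SubspacePoset F) := fun W => ⟨W.1, W.2, ⟨subspacePosetIic W⟩⟩

theorem IsQPoset.hasSubspaceIdeals {F : Type*} [Field F] {P : Type*} [PartialOrder P]
    (h : IsQPoset F P) : HasSubspaceIdeals F P := fun x => by
  obtain ⟨y, ⟨e⟩⟩ := h.2 x
  obtain ⟨W, hW, ⟨e'⟩⟩ := hasSubspaceIdeals_subspacePoset F y
  exact ⟨W, hW, ⟨e.trans e'⟩⟩

variable {F : Type*} [Field F] {P : Type*} [PartialOrder P]
  {V : Type*} [AddCommGroup V] [Module F V] [FiniteDimensional F V]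

theorem height_eq_finrank {x : P} (e : Set.Iic x ≃o Submodule F V) (z : Set.Iic x) :
    Order.height (z : P) = finrank F (e z) := by
  rw [← height_submodule_eq_finrank, Order.height_orderIso]
  exact (height_subtype_of_lower (p := fun y => y ≤ x) (fun _ _ h h' => h.trans h') z).symm

theorem quasiRank_eq_finrank {x : P} (e : Set.Iic x ≃o Submodule F V) (z : Set.Iic x) :
    quasiRank (z : P) = finrank F (e z) := by
  rw [quasiRank, height_eq_finrank e]; rfl

theorem quasiRank_top_eq_finrank {x : P} (e : Set.Iic x ≃o Submodule F V) :
    quasiRank x = finrank F V := by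
  have := quasiRank_eq_finrank e ⊤
  rwa [map_top, finrank_top] at this

/-- Heights are finite here, so the truncation in `quasiRank` loses nothing. -/
theorem HasSubspaceIdeals.height_eq (h : HasSubspaceIdeals F P) (x : P) :
    Order.height x = quasiRank x := by
  obtain ⟨W, hW, ⟨e⟩⟩ := h x
  rw [quasiRank_top_eq_finrank e]
  have := height_eq_finrank e ⊤
  rwa [map_top, finrank_top] at this

theorem HasSubspaceIdeals.quasiRank_lt (h : HasSubspaceIdeals F P) {x y : P} (hxy : x < y) :
    quasiRank x < quasiRank y := by
  have := Order.height_strictMono hxy (by rw [h.height_eq]; exact ENat.natCast_lt_top _)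
  rwa [h.height_eq, h.height_eq, Nat.cast_lt] at this

theorem HasSubspaceIdeals.quasiRank_le (h : HasSubspaceIdeals F P) {x y : P} (hxy : x ≤ y) :
    quasiRank x ≤ quasiRank y := by
  rcases hxy.eq_or_lt with rfl | hlt
  · exact le_rfl
  · exact (h.quasiRank_lt hlt).le

theorem sum_ideal [Fintype P] [DecidableEq P] {x : P}
    (e : Set.Iic x ≃o Submodule F V) [Fintype (Submodule F V)] (H : Finset (Submodule F V))
    (p : P → Prop) [DecidablePred p] [DecidablePred (· ≤ x)]
    (hp : ∀ z : Set.Iic x, p z ↔ ∀ G ∈ H, ¬ e z ≤ G) :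
    ∑ z with z ≤ x ∧ p z, (X : ℝ[X]) ^ quasiRank z =
      avoidPoly (fun W : Submodule F V => finrank F W) ⊤ H := by
  classical
  rw [avoidPoly]
  refine Finset.sum_bij' (fun z hz => e ⟨z, (Finset.mem_filter.1 hz).2.1⟩)
    (fun D _ => (e.symm D).1) ?_ ?_ ?_ ?_ ?_
  · intro z hz
    have := (Finset.mem_filter.1 hz).2
    simp only [Finset.mem_filter, Finset.mem_univ, true_and, le_top]
    exact (hp ⟨z, this.1⟩).1 this.2
  · intro D hD
    have := (Finset.mem_filter.1 hD).2.2
    simp only [Finset.mem_filter, Finset.mem_univ, true_and]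
    exact ⟨(e.symm D).2, (hp _).2 (by simpa using this)⟩
  · intro z hz; simp
  · intro D hD; exact e.apply_symm_apply D
  · intro z hz
    rw [quasiRank_eq_finrank e ⟨z, (Finset.mem_filter.1 hz).2.1⟩]

variable [Finite F]

theorem finite_submodule : Finite (Submodule F V) := by
  have : Finite V := Module.finite_of_finite F
  infer_instance

theorem HasSubspaceIdeals.finite_Iic (h : HasSubspaceIdeals F P) (x : P) :
    Finite (Set.Iic x) := by
  obtain ⟨W, hW, ⟨e⟩⟩ := h x
  have := finite_submodule (F := F) (V := W)
  exact Finite.of_equiv _ e.symm.toEquiv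

theorem HasSubspaceIdeals.idealCount_eq (h : HasSubspaceIdeals F P) (x : P) (k : ℕ) :
    (idealCount x k : ℝ) = (qResolvent (Nat.card F : ℝ) (quasiRank x) 0).coeff k := by
  classical
  obtain ⟨W, hW, ⟨e⟩⟩ := h x
  have := finite_submodule (F := F) (V := W)
  have := Fintype.ofFinite (Submodule F W)
  have hL := isSubspaceLattice_submodule (F := F) (V := W)
  have h1 := hL.avoidPoly_empty ⊤
  rw [finrank_top] at h1
  rw [quasiRank_top_eq_finrank e, ← h1, coeff_avoidPoly, idealCount, ← Nat.card_coe_set_eq,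
    ← Fintype.card_subtype, ← Nat.card_eq_fintype_card, Nat.cast_inj]
  refine Nat.card_congr
    { toFun := fun z => ⟨e ⟨z.1, z.2.1⟩, by simp [← quasiRank_eq_finrank, z.2.2]⟩
      invFun := fun D => ⟨(e.symm D.1).1, (e.symm D.1).2, by
        rw [quasiRank_eq_finrank e, OrderIso.apply_symm_apply]; exact D.2.2⟩
      left_inv := fun z => by simp
      right_inv := fun D => Subtype.ext (e.apply_symm_apply D.1) }

end Ideals

/-! ### Positivity from a shelling -/

section Shelling

open Module

variable {F : Type*} [Field F] {P : Type*} [PartialOrder P]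

/-- Ensures that no row of the rank matrix of 𝔹(q) takes the default value 0. -/
theorem exists_subspace_of_finrank (F : Type*) [Field F] (n : ℕ) :
    ∃ x : SubspacePoset F, quasiRank x = n := by
  have hli : LinearIndependent F (fun i : Fin n => Pi.single (M := fun _ => F) (i : ℕ) 1) :=
    (Pi.linearIndependent_single_one ℕ F).comp _ Fin.val_injective
  have hfin : FiniteDimensional F (Submodule.span F (Set.range
      (fun i : Fin n => Pi.single (M := fun _ => F) (i : ℕ) 1))) :=
    FiniteDimensional.span_of_finite F (Set.finite_range _)
  refine ⟨⟨_, hfin⟩, ?_⟩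
  rw [quasiRank_top_eq_finrank (subspacePosetIic ⟨_, hfin⟩), finrank_span_eq_card hli,
    Fintype.card_fin]

theorem covBy_top_of_quasiRank {x z : P} {W : Submodule F (ℕ → F)}
    [FiniteDimensional F W]
    (e : Set.Iic x ≃o Submodule F W) (hz : z ≤ x) (hr : quasiRank z + 1 = quasiRank x) :
    e ⟨z, hz⟩ ⋖ ⊤ := by
  have h1 : quasiRank z = _ := quasiRank_eq_finrank e ⟨z, hz⟩
  rw [h1, quasiRank_top_eq_finrank e] at hr
  refine ⟨lt_top_iff_ne_top.2 fun h => ?_, fun B hB hB' => ?_⟩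
  · rw [h, finrank_top] at hr; omega
  · have h2 := Submodule.finrank_lt_finrank_of_lt hB
    have h3 := Submodule.finrank_lt hB'.ne
    omega

theorem IsPureOfRank.posetRank_eq {n : ℕ} (h : IsPureOfRank P n) (hP : HasSubspaceIdeals F P) :
    posetRank P = n := by
  have := h.finite
  obtain ⟨x⟩ := h.nonempty
  have hle : ∀ x : P, ∃ y, x ≤ y ∧ quasiRank y = n := fun x => by
    obtain ⟨y, hxy, hy⟩ := Finite.exists_le_maximal (p := fun _ : P => True) (a := x) trivial
    exact ⟨y, hxy, h.pure y (maximal_true.1 hy)⟩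
  refine le_antisymm (iSup_le fun x => ?_) ?_
  · obtain ⟨y, hxy, hy⟩ := hle x
    have := hP.quasiRank_le hxy
    exact_mod_cast hy ▸ this
  · obtain ⟨y, -, hy⟩ := hle x
    exact le_iSup_of_le y (by rw [hy])

/-- Serves to show h_0 = 1. -/
theorem coeff_rankGenPoly_zero [Finite P] (hP : HasSubspaceIdeals F P) (hb : ∃ b : P, IsBot b) :
    (rankGenPoly P).coeff 0 = 1 := by
  classical
  have := Fintype.ofFinite P
  obtain ⟨b, hb⟩ := hb
  rw [rankGenPoly, finsum_eq_sum_of_fintype, finsetSum_coeff, Finset.sum_eq_single b]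
  · have : quasiRank b = 0 := by
      rw [quasiRank, Order.height_eq_zero.2 hb.isMin]; rfl
    simp [this]
  · intro x _ hx
    have := hP.quasiRank_lt (lt_of_le_of_ne (hb x) hx.symm)
    rw [coeff_X_pow, if_neg (by omega)]
  · simp

variable [Finite F]

theorem HasSubspaceIdeals.isQuasiRankUniform (h : HasSubspaceIdeals F P) (hb : ∃ b : P, IsBot b) :
    IsQuasiRankUniform P where
  locallyFinite a b := by
    have := h.finite_Iic b
    exact (Set.toFinite (Set.Iic b)).subset Set.Icc_subset_Iic_self
  exists_bot := hb
  uniform x y hxy k _ := by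
    rw [← Nat.cast_inj (R := ℝ), h.idealCount_eq, h.idealCount_eq, hxy]

theorem HasSubspaceIdeals.rankMatrix_eq (h : HasSubspaceIdeals F P) {n : ℕ}
    (hn : ∃ x : P, quasiRank x = n) (k : ℕ) :
    rankMatrix P n k = (qResolvent (Nat.card F : ℝ) n 0).coeff k := by
  rw [rankMatrix, dif_pos hn, h.idealCount_eq, hn.choose_spec]

theorem rankMatrix_subspacePoset (n k : ℕ) :
    rankMatrix (SubspacePoset F) n k = (qResolvent (Nat.card F : ℝ) n 0).coeff k :=
  (hasSubspaceIdeals_subspacePoset F).rankMatrix_eq (exists_subspace_of_finrank F n) k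

theorem rowPoly_subspacePoset (n : ℕ) :
    rowPoly (rankMatrix (SubspacePoset F)) n = qResolvent (Nat.card F : ℝ) n 0 := by
  ext j
  simp only [rowPoly, rankMatrix_subspacePoset, finsetSum_coeff, coeff_C_mul, coeff_X_pow,
    mul_ite, mul_one, mul_zero, Finset.sum_ite_eq, Finset.mem_range]
  split_ifs with h
  · rfl
  · rw [coeff_qResolvent_of_gt _ (Nat.zero_le _) (by omega)]

theorem isResolution_subspacePoset :
    IsResolution (posetRank (SubspacePoset F)) (rankMatrix (SubspacePoset F))
      (fun _ k => (Nat.card F : ℝ) ^ k) (qResolvent (Nat.card F : ℝ)) where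
  lam_nonneg n k _ _ := by positivity
  monic n k h _ := monic_qResolvent _ h
  first n _ := (rowPoly_subspacePoset n).symm
  last n _ := qResolvent_self _ n
  dvd n k h _ := X_pow_dvd_qResolvent _ h
  step n k h _ := qResolvent_step _ h
  normalized n k _ _ h := h

theorem HasSubspaceIdeals.isCombinatorialPosetOver (h : HasSubspaceIdeals F P)
    (hb : ∃ b : P, IsBot b) : IsCombinatorialPosetOver (SubspacePoset F) P := by
  refine ⟨h.isQuasiRankUniform hb, fun y => ?_⟩
  obtain ⟨W, hW, ⟨e⟩⟩ := h y
  have := finite_submodule (F := F) (V := W)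
  have := Fintype.ofFinite (Submodule F W)
  have h1 := (isSubspaceLattice_submodule (F := F) (V := W)).avoidPoly_empty ⊤
  rw [finrank_top] at h1
  rw [rowPoly_subspacePoset, quasiRank_top_eq_finrank e, ← h1, avoidPoly,
    finsum_eq_of_bijective e e.bijective (g := fun D : Submodule F W => (X : ℝ[X]) ^ finrank F D)
      (fun z => by rw [quasiRank_eq_finrank e]), finsum_eq_sum_of_fintype]
  simp

theorem HasSubspaceIdeals.rankGenPoly_expansion [Finite P] (hP : HasSubspaceIdeals F P) {n : ℕ}
    (hn : IsPureOfRank P n) {m : ℕ} (f : Fin m ≃ {x : P // IsMax x})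
    (hf : ∀ k : Fin m, 0 < (k : ℕ) → ∃ d : ℕ, d + 1 = n ∧
      IsPureOfRank {x : P // (∃ i < k, x ≤ (f i : P)) ∧ x ≤ (f k : P)} d) :
    ∃ a : ℕ → ℝ, (∀ k ≤ n, 0 ≤ a k) ∧
      rankGenPoly P = ∑ k ∈ Finset.range (n + 1), C (a k) * qResolvent (Nat.card F : ℝ) n k := by
  classical
  have := Fintype.ofFinite P
  have hex : ∀ x : P, ∃ i, x ≤ (f i : P) := fun x => by
    obtain ⟨y, hxy, hy⟩ := Finite.exists_le_maximal (p := fun _ : P => True) (a := x) trivial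
    exact ⟨f.symm ⟨y, maximal_true.1 hy⟩, by simpa using hxy⟩
  have hfirst : ∀ x : P, ∃ i, x ≤ (f i : P) ∧ ∀ j < i, ¬ x ≤ (f j : P) := fun x => by
    obtain ⟨i, hi, hmin⟩ := WellFounded.has_min (wellFounded_lt (α := Fin m))
      {i | x ≤ (f i : P)} (hex x)
    exact ⟨i, hi, fun j hj h => hmin j h hj⟩
  -- The index `t x` of the first facet above x partitions P.
  choose t ht ht' using hfirst
  have htk : ∀ x k, t x = k ↔ x ≤ (f k : P) ∧ ∀ j < k, ¬ x ≤ (f j : P) := fun x k => by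
    refine ⟨by rintro rfl; exact ⟨ht x, ht' x⟩, fun h => ?_⟩
    rcases lt_trichotomy (t x) k with h1 | h1 | h1
    · exact absurd (ht x) (h.2 _ h1)
    · exact h1
    · exact absurd h.1 (ht' x _ h1)
  have hpart : ∀ k : Fin m, ∃ a : ℕ → ℝ, (∀ i ≤ n, 0 ≤ a i) ∧
      ∑ x with t x = k, (X : ℝ[X]) ^ quasiRank x =
        ∑ i ∈ Finset.range (n + 1), C (a i) * qResolvent (Nat.card F : ℝ) n i := by
    intro k
    obtain ⟨W, hW, ⟨e⟩⟩ := hP (f k)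
    have := finite_submodule (F := F) (V := W)
    have := Fintype.ofFinite (Submodule F W)
    have hL := isSubspaceLattice_submodule (F := F) (V := W)
    have hrk := hn.pure _ (f k).2
    -- The hyperplanes of the k-th facet that already lie below an earlier facet.
    let H : Finset (Submodule F W) :=
      {D | D ⋖ ⊤ ∧ ∃ i < k, ((e.symm D : Set.Iic (f k : P)) : P) ≤ (f i : P)}
    have hH : ∀ z : Set.Iic (f k : P),
        (∀ j < k, ¬ (z : P) ≤ (f j : P)) ↔ ∀ G ∈ H, ¬ e z ≤ G := by
      intro z
      rw [← not_iff_not]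
      push Not
      constructor
      -- An element below an earlier facet lies under a maximal element of the intersection. Purity
      -- gives that element rank n - 1, so it is a hyperplane belonging to H.
      · rintro ⟨j, hj, hz⟩
        obtain ⟨d, hd, hpure⟩ := hf k (lt_of_le_of_lt (Nat.zero_le _) (Fin.lt_def.1 hj))
        have hlow : ∀ x y : P, x ≤ y → ((∃ i < k, y ≤ (f i : P)) ∧ y ≤ (f k : P)) →
            ((∃ i < k, x ≤ (f i : P)) ∧ x ≤ (f k : P)) :=
          fun x y hxy ⟨⟨i, hi, h1⟩, h2⟩ => ⟨⟨i, hi, hxy.trans h1⟩, hxy.trans h2⟩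
        obtain ⟨y, hzy, hy⟩ := Finite.exists_le_maximal
          (α := {x : P // (∃ i < k, x ≤ (f i : P)) ∧ x ≤ (f k : P)}) (p := fun _ => True)
          (a := ⟨z, ⟨j, hj, hz⟩, z.2⟩) trivial
        have hyr := hpure.pure y (maximal_true.1 hy)
        rw [quasiRank_subtype_of_lower hlow] at hyr
        refine ⟨e ⟨y, y.2.2⟩, ?_, e.monotone hzy⟩
        simp only [H, Finset.mem_filter, Finset.mem_univ, true_and, OrderIso.symm_apply_apply]
        exact ⟨covBy_top_of_quasiRank e y.2.2 (by omega), y.2.1⟩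
      · rintro ⟨G, hG, hz⟩
        obtain ⟨-, i, hi, hGi⟩ := (Finset.mem_filter.1 hG).2
        exact ⟨i, hi, le_trans (e.le_symm_apply.2 hz) hGi⟩
    obtain ⟨a, ha, hsum⟩ := hL.exists_nonneg_expansion ⊤ H fun G hG => by
      rw [inf_top_eq]; exact Or.inr (Finset.mem_filter.1 hG).2.1
    rw [finrank_top, ← quasiRank_top_eq_finrank e, hrk] at ha hsum
    refine ⟨a, ha, ?_⟩
    rw [← hsum, ← sum_ideal e H (fun z => ∀ j < k, ¬ z ≤ (f j : P)) hH]
    simp only [htk]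
  choose a ha hsum using hpart
  refine ⟨fun i => ∑ k, a k i, fun i hi => Finset.sum_nonneg fun k _ => ha k i hi, ?_⟩
  rw [rankGenPoly, finsum_eq_sum_of_fintype, ← Finset.sum_fiberwise _ t]
  simp only [hsum, map_sum, Finset.sum_mul]
  rw [Finset.sum_comm]

theorem qResolvent_expansion_unique {q : ℝ} (hq : q ≠ 0) {n : ℕ} {a b : ℕ → ℝ}
    (h : ∑ k ∈ Finset.range (n + 1), C (a k) * qResolvent q n k =
      ∑ k ∈ Finset.range (n + 1), C (b k) * qResolvent q n k) : ∀ k ≤ n, a k = b k := by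
  intro k hk
  refine sub_eq_zero.1
    (qResolvent_coeffs_unique q hq (a := fun k => a k - b k) (fun j _ => ?_) k hk)
  have := congrArg (fun f => coeff f j) h
  simp only [coeff_sum_qResolvent] at this
  simp only [sub_mul, Finset.sum_sub_distrib, this, sub_self]

end Shelling

/-! ### Total nonnegativity of the Gaussian binomial matrix -/

section TotallyNonneg

/-- Multiplication on the right by a nonnegative lower bidiagonal matrix with unit diagonal
preserves nonnegativity of minors. -/
theorem det_nonneg_of_bidiagonal {A R : ℕ → ℕ → ℝ} {c : ℕ → ℝ} (hc : ∀ k, 0 ≤ c k)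
    (hR : ∀ n k, R n k = A n k + c k * A n (k + 1)) {m : ℕ} {f : Fin m → ℕ}
    (hA : ∀ g : Fin m → ℕ, StrictMono g → 0 ≤ (Matrix.of fun i j => A (f i) (g j)).det)
    {g : Fin m → ℕ} (hg : StrictMono g) : 0 ≤ (Matrix.of fun i j => R (f i) (g j)).det := by
  classical
  have hterm : ∀ s : Finset (Fin m), s.piecewise (fun j i => A (f i) (g j))
      (fun j i => c (g j) * A (f i) (g j + 1)) = fun j => (if j ∈ s then 1 else c (g j)) •
        (fun i => A (f i) (if j ∈ s then g j else g j + 1)) := by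
    intro s
    funext j i
    by_cases hj : j ∈ s <;> simp [Finset.piecewise, hj]
  rw [← Matrix.det_transpose]
  have : (Matrix.of fun i j => R (f i) (g j)).transpose =
      Matrix.of ((fun j i => A (f i) (g j)) + fun j i => c (g j) * A (f i) (g j + 1)) := by
    ext j i
    simp [hR]
  rw [this]
  change 0 ≤ (Matrix.detRowAlternating (n := Fin m) (R := ℝ)).toMultilinearMap
    ((fun j i => A (f i) (g j)) + fun j i => c (g j) * A (f i) (g j + 1))
  -- Each column is a nonnegative combination of columns g j and g j + 1 of A; s records where the
  -- first is chosen.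
  rw [MultilinearMap.map_add_univ]
  refine Finset.sum_nonneg fun s _ => ?_
  rw [hterm, MultilinearMap.map_smul_univ, smul_eq_mul]
  refine mul_nonneg (Finset.prod_nonneg fun j _ => ?_) ?_
  · split_ifs
    · exact zero_le_one
    · exact hc _
  change 0 ≤ (Matrix.of fun j i => A (f i) (if j ∈ s then g j else g j + 1)).det
  -- The chosen column indices are weakly increasing, so they are either strictly increasing or two
  -- of them coincide and the minor is zero.
  by_cases hmono : StrictMono (fun j => if j ∈ s then g j else g j + 1)
  · have := hA _ hmono
    rwa [← Matrix.det_transpose] at this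
  · simp only [StrictMono, not_forall] at hmono
    obtain ⟨a, b, hab, hle⟩ := hmono
    have h1 := hg hab
    have heq : (if a ∈ s then g a else g a + 1) = if b ∈ s then g b else g b + 1 := by
      split_ifs at hle ⊢ <;> omega
    rw [Matrix.det_zero_of_row_eq hab.ne]
    funext i
    simp only [Matrix.of_apply, heq]

/-- The direct sum of a `1 × 1` identity matrix with an infinite matrix. -/
def oneDirectSum (R : ℕ → ℕ → ℝ) : ℕ → ℕ → ℝ
  | 0, 0 => 1
  | 0, _ + 1 => 0
  | _ + 1, 0 => 0
  | n + 1, k + 1 => R n k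

/-- A minor using both row 0 and column 0 loses them by expansion; one using exactly one of them has
a zero line; any other is a shifted minor of R. -/
theorem det_oneDirectSum_nonneg {R : ℕ → ℕ → ℝ} {N : ℕ}
    (hR : ∀ (m : ℕ) (f g : Fin m → ℕ), StrictMono f → StrictMono g → (∀ i, f i < N) →
      0 ≤ (Matrix.of fun i j => R (f i) (g j)).det)
    {m : ℕ} {f g : Fin m → ℕ} (hf : StrictMono f) (hg : StrictMono g) (hfN : ∀ i, f i < N + 1) :
    0 ≤ (Matrix.of fun i j => oneDirectSum R (f i) (g j)).det := by
  have shift : ∀ {m : ℕ} {f g : Fin m → ℕ}, StrictMono f → StrictMono g → (∀ i, f i < N + 1) →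
      (∀ i, 0 < f i) → (∀ i, 0 < g i) →
      0 ≤ (Matrix.of fun i j => oneDirectSum R (f i) (g j)).det := by
    intro m f g hf hg hfN hf0 hg0
    have := hR m (fun i => f i - 1) (fun i => g i - 1)
      (fun a b hab => by have := hf hab; have := hf0 a; show f a - 1 < f b - 1; omega)
      (fun a b hab => by have := hg hab; have := hg0 a; show g a - 1 < g b - 1; omega)
      (fun i => by have := hfN i; have := hf0 i; omega)
    suffices h : (Matrix.of fun i j => oneDirectSum R (f i) (g j)) =
        Matrix.of fun i j => R (f i - 1) (g j - 1) by rwa [h]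
    ext i j
    simp only [Matrix.of_apply]
    obtain ⟨a, ha⟩ := Nat.exists_eq_succ_of_ne_zero (hf0 i).ne'
    obtain ⟨b, hb⟩ := Nat.exists_eq_succ_of_ne_zero (hg0 j).ne'
    rw [ha, hb]
    rfl
  have pos_of : ∀ {m : ℕ} {f : Fin (m + 1) → ℕ}, StrictMono f → 0 < f 0 → ∀ i, 0 < f i :=
    fun hf h i => h.trans_le (hf.monotone (Fin.zero_le i))
  have pos_succ : ∀ {m : ℕ} {f : Fin (m + 1) → ℕ}, StrictMono f → ∀ i : Fin m, 0 < f i.succ :=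
    fun hf i => lt_of_le_of_lt (Nat.zero_le _) (hf (Fin.succ_pos i))
  cases m with
  | zero => simp
  | succ m =>
    rcases Nat.eq_zero_or_pos (f 0) with hf0 | hf0 <;>
      rcases Nat.eq_zero_or_pos (g 0) with hg0 | hg0
    · rw [Matrix.det_succ_row_zero, Finset.sum_eq_single 0]
      · have := shift (f := fun i : Fin m => f i.succ) (g := fun i : Fin m => g i.succ)
          (hf.comp (Fin.strictMono_succ)) (hg.comp (Fin.strictMono_succ)) (fun i => hfN _)
          (pos_succ hf) (pos_succ hg)
        simpa [hf0, hg0, oneDirectSum, Matrix.submatrix, Fin.succAbove_zero] using this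
      · intro j _ hj
        obtain ⟨i, rfl⟩ := Fin.exists_succ_eq.2 hj
        obtain ⟨b, hb⟩ := Nat.exists_eq_succ_of_ne_zero (pos_succ hg i).ne'
        simp [hf0, hb, oneDirectSum]
      · simp
    · rw [Matrix.det_eq_zero_of_row_eq_zero 0]
      intro j
      obtain ⟨b, hb⟩ := Nat.exists_eq_succ_of_ne_zero (pos_of hg hg0 j).ne'
      simp [hf0, hb, oneDirectSum]
    · rw [Matrix.det_eq_zero_of_column_eq_zero 0]
      intro j
      obtain ⟨b, hb⟩ := Nat.exists_eq_succ_of_ne_zero (pos_of hf hf0 j).ne'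
      simp [hg0, hb, oneDirectSum]
    · exact shift hf hg hfN (pos_of hf hf0) (pos_of hg hg0)

/-- Gaussian binomial coefficients form a totally nonnegative matrix. -/
theorem det_coeff_qResolvent_nonneg {q : ℝ} (hq : 0 ≤ q) (N : ℕ) :
    ∀ (m : ℕ) (f g : Fin m → ℕ), StrictMono f → StrictMono g → (∀ i, f i < N) →
      0 ≤ (Matrix.of fun i j => (qResolvent q (f i) 0).coeff (g j)).det := by
  induction N with
  | zero =>
    intro m f g _ _ hN
    cases m with
    | zero => simp
    | succ m => exact absurd (hN 0) (Nat.not_lt_zero _)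
  | succ N ih =>
    intro m f g hf hg hN
    -- The q-Pascal recursion says R = (1 ⊕ R) B with B bidiagonal. Rows of 1 ⊕ R below N + 1
    -- involve only rows of R below N, whence the induction on N.
    refine det_nonneg_of_bidiagonal (R := fun n k => (qResolvent q n 0).coeff k)
      (A := oneDirectSum fun n k => (qResolvent q n 0).coeff k) (c := fun k => q ^ k)
      (fun k => by positivity) (fun n k => ?_) (fun g hg => det_oneDirectSum_nonneg ih hf hg hN) hg
    rcases n with _ | n <;> rcases k with _ | k
    · simp [oneDirectSum]
    · simp [oneDirectSum, coeff_one]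
    · rw [qResolvent_succ q (Nat.zero_le n), coeff_qRaise_zero]; simp [oneDirectSum]
    · rw [qResolvent_succ q (Nat.zero_le n), coeff_qRaise_succ]; simp [oneDirectSum]

theorem isTNPoset_subspacePoset {F : Type*} [Field F] [Finite F] :
    IsTNPoset (SubspacePoset F) := by
  refine ⟨(hasSubspaceIdeals_subspacePoset F).isQuasiRankUniform ?_, ?_⟩
  · exact ⟨⟨⊥, inferInstance⟩, fun W => Subtype.mk_le_mk.2 bot_le⟩
  · intro m f g hf hg _ _
    simp only [rankMatrix_subspacePoset]
    exact det_coeff_qResolvent_nonneg (Nat.cast_nonneg _) (∑ i, f i + 1) m f g hf hg fun i =>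
      Nat.lt_succ_of_le (Finset.single_le_sum (f := f) (fun _ _ => Nat.zero_le _)
        (Finset.mem_univ i))

end TotallyNonneg

/-! ### Interlacing at a point of the upper half plane -/

section UpperHalfPlane

open ComplexConjugate

/-- A real polynomial without zeros in the open upper half plane is real-rooted. -/
theorem splits_of_aeval_ne_zero {f : ℝ[X]} (h : ∀ z : ℂ, 0 < z.im → aeval z f ≠ 0) :
    f.Splits := by
  suffices key : ∀ g : ℝ[X], Irreducible g → g ∣ f → degree g = 1 by
    by_cases hf0 : f = 0
    · simp [hf0]
    obtain ⟨w, hw⟩ := UniqueFactorizationMonoid.factors_prod hf0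
    rw [← hw]
    exact (Splits.multisetProd fun g hg => Splits.of_degree_eq_one
      (key g (UniqueFactorizationMonoid.irreducible_of_factor g hg)
        (UniqueFactorizationMonoid.dvd_of_mem_factors hg))).mul w.isUnit.splits
  intro g hg hgf
  have hdeg : (g.map (algebraMap ℝ ℂ)).degree ≠ 0 := by
    rw [degree_map]; exact hg.degree_pos.ne'
  obtain ⟨z, hz⟩ := IsAlgClosed.exists_root _ hdeg
  have hz' : aeval z g = 0 := by rwa [IsRoot, eval_map_algebraMap] at hz
  obtain ⟨k, rfl⟩ := hgf
  rcases lt_trichotomy z.im 0 with hlt | heq | hgt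
  · refine absurd ?_ (h (conj z) (by simpa using hlt))
    rw [map_mul, aeval_conj, hz']; simp
  · have hzr : z = ((z.re : ℝ) : ℂ) := by apply Complex.ext <;> simp [heq]
    refine degree_eq_one_of_irreducible_of_root hg (x := z.re) ?_
    rw [hzr] at hz'
    have : algebraMap ℝ ℂ (aeval z.re g) = 0 := by rw [← aeval_algebraMap_apply]; exact hz'
    simpa using this
  · exact absurd (by rw [map_mul, hz', zero_mul]) (h z hgt)

/-- The convex cone spanned by `1` and `u`. -/
def InCone (u w : ℂ) : Prop := ∃ a b : ℝ, 0 ≤ a ∧ 0 ≤ b ∧ w = a + b * u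

variable {u : ℂ}

theorem InCone.add {w w' : ℂ} (h : InCone u w) (h' : InCone u w') : InCone u (w + w') := by
  obtain ⟨a, b, ha, hb, rfl⟩ := h
  obtain ⟨a', b', ha', hb', rfl⟩ := h'
  exact ⟨a + a', b + b', by positivity, by positivity, by push_cast; ring⟩

theorem InCone.real_mul {w : ℂ} (h : InCone u w) {c : ℝ} (hc : 0 ≤ c) : InCone u (c * w) := by
  obtain ⟨a, b, ha, hb, rfl⟩ := h
  exact ⟨c * a, c * b, by positivity, by positivity, by push_cast; ring⟩

theorem inCone_zero : InCone u 0 := ⟨0, 0, le_rfl, le_rfl, by simp⟩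

theorem inCone_self : InCone u u := ⟨0, 1, le_rfl, zero_le_one, by simp⟩

theorem inCone_mul_conj (w : ℂ) : InCone u (w * conj w) :=
  ⟨Complex.normSq w, 0, Complex.normSq_nonneg _, le_rfl, by simp [Complex.mul_conj]⟩

theorem InCone.mul_conj {w : ℂ} (h : InCone u w) : InCone u (u * conj w) := by
  obtain ⟨a, b, ha, hb, rfl⟩ := h
  refine ⟨b * Complex.normSq u, a, mul_nonneg hb (Complex.normSq_nonneg u), ha, ?_⟩
  simp only [map_add, map_mul, Complex.conj_ofReal]
  push_cast
  rw [← Complex.mul_conj]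
  ring

theorem inCone_sum {ι : Type*} (s : Finset ι) {v : ι → ℂ} (h : ∀ i ∈ s, InCone u (v i)) :
    InCone u (∑ i ∈ s, v i) :=
  Finset.sum_induction _ _ (fun _ _ => InCone.add) inCone_zero h

theorem inCone_sum_mul_conj_sum {ι : Type*} {s t : Finset ι} {v : ι → ℂ}
    (h : ∀ i ∈ s, ∀ j ∈ t, InCone u (v j * conj (v i))) :
    InCone u ((∑ j ∈ t, v j) * conj (∑ i ∈ s, v i)) := by
  rw [map_sum, Finset.sum_mul_sum]
  exact inCone_sum _ fun j hj => inCone_sum _ fun i hi => h i hi j hj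

/-- Multiplied by the conjugate of v_0, the sum is |v_0|² + a + bu with a, b ≥ 0. If it vanished,
the imaginary part would force b = 0, and then the real part would be positive. -/
theorem sum_ne_zero_of_inCone (hu : 0 < u.im) {n : ℕ} {v : ℕ → ℂ} (h0 : v 0 ≠ 0)
    (h : ∀ j ≤ n, InCone u (v j * conj (v 0))) : ∑ j ∈ Finset.range (n + 1), v j ≠ 0 := by
  intro hsum
  have hc : InCone u (∑ j ∈ Finset.range n, v (j + 1) * conj (v 0)) :=
    inCone_sum _ fun j hj => h _ (by have := Finset.mem_range.1 hj; omega)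
  obtain ⟨a, b, ha, hb, hab⟩ := hc
  have h1 : (a : ℂ) + b * u + Complex.normSq (v 0) = 0 := by
    rw [← hab, ← Complex.mul_conj, ← Finset.sum_range_succ' (fun j => v j * conj (v 0)),
      ← Finset.sum_mul, hsum, zero_mul]
  have him := congrArg Complex.im h1
  have hre := congrArg Complex.re h1
  simp only [Complex.add_im, Complex.ofReal_im, Complex.mul_im, Complex.ofReal_re, zero_mul,
    add_zero, zero_add, Complex.zero_im, Complex.add_re, Complex.mul_re, sub_zero,
    Complex.zero_re] at him hre
  have hb0 : b = 0 := (mul_eq_zero.1 him).resolve_right hu.ne'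
  have := Complex.normSq_pos.2 h0
  rw [hb0] at hre
  linarith

/-- The linear step of the recursion for chain polynomials preserves the cone condition. -/
theorem inCone_step {A M B : ℂ} (hAM : InCone u (M * conj A)) (hMB : InCone u (B * conj M)) :
    InCone u ((u * (A + M) + B) * conj (u * A + (M + B))) := by
  have h1 : InCone u ((u * A + B) * conj M) := by
    have := hAM.mul_conj.add hMB
    convert this using 1
    simp only [map_mul, Complex.conj_conj]; ring
  have h2 := h1.mul_conj
  have h3 : InCone u (Complex.normSq M * u) := inCone_self.real_mul (Complex.normSq_nonneg M)
  -- With w = uA + B the product is (w + uM) conj(w + M) = |w|² + w conj M + u conj(w conj M) +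
  -- u|M|², and each summand is in the cone.
  convert ((inCone_mul_conj (u * A + B)).add h1).add (h2.add h3) using 1
  rw [← Complex.mul_conj]
  simp only [map_add, map_mul, Complex.conj_conj]
  ring

variable {q : ℝ}

/-- The step recursion telescoped down from R_{n+1,n+1} = t^{n+1}. -/
theorem qResolvent_succ_eq_sum {n k : ℕ} (h : k ≤ n + 1) :
    qResolvent q (n + 1) k =
      X ^ (n + 1) + ∑ j ∈ Finset.Ico k (n + 1), q ^ j • qResolvent q n j := by
  induction h using Nat.decreasingInduction with
  | self => simp
  | of_succ k h ih =>
    rw [qResolvent_step q (Nat.lt_succ_iff.1 h), ih, Finset.sum_eq_sum_Ico_succ_bot h,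
      smul_eq_C_mul]
    ring

/-- Suppose that a linear functional on polynomials satisfies the recursion that encodes chain
counting with ranks in `S`, at a point `z` of the upper half plane. Then its values at the
polynomials `R^q_{n,k}` form an interlacing sequence. -/
theorem inCone_functional (hq : 0 < q) {z : ℂ} (hz : 0 < z.im) {S : Set ℕ} (Φ : ℝ[X] →ₗ[ℝ] ℂ)
    (h0 : Φ 1 ≠ 0) (hS : ∀ n, n + 1 ∉ S → Φ (X ^ (n + 1)) = 0)
    (hS' : ∀ n, n + 1 ∈ S →
      Φ (X ^ (n + 1)) = z * (Φ (qResolvent q (n + 1) 0) - Φ (X ^ (n + 1)))) (n : ℕ) :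
    Φ (qResolvent q n 0) ≠ 0 ∧ ∀ i j, i ≤ j → j ≤ n →
      InCone (z / (1 + z)) (Φ (qResolvent q n j) * conj (Φ (qResolvent q n i))) := by
  have hz1 : 1 + z ≠ 0 := fun h => by
    have := congrArg Complex.im h
    simp at this; linarith
  set u := z / (1 + z) with hudef
  have hu : 0 < u.im := by
    have : u.im = z.im / Complex.normSq (1 + z) := by
      rw [hudef, Complex.div_im]; simp; ring
    rw [this]
    exact div_pos hz (Complex.normSq_pos.2 hz1)
  have hzu : z = (1 + z) * u := by rw [hudef]; field_simp
  induction n with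
  | zero =>
    refine ⟨by simpa using h0, fun i j hij hj => ?_⟩
    obtain rfl : j = 0 := by omega
    obtain rfl : i = 0 := by omega
    exact inCone_mul_conj _
  | succ n ih =>
    obtain ⟨hne, hcone⟩ := ih
    set v : ℕ → ℂ := fun j => q ^ j • Φ (qResolvent q n j) with hv
    have hvcone : ∀ i j, i ≤ j → j ≤ n → InCone u (v j * conj (v i)) := fun i j hij hj => by
      have := (hcone i j hij hj).real_mul (show 0 ≤ q ^ j * q ^ i by positivity)
      convert this using 1
      simp only [hv, Complex.real_smul, map_mul, Complex.conj_ofReal]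
      push_cast
      ring
    have hv0 : v 0 ≠ 0 := by simpa [hv] using hne
    have hexp : ∀ k ≤ n + 1, Φ (qResolvent q (n + 1) k) =
        Φ (X ^ (n + 1)) + ∑ j ∈ Finset.Ico k (n + 1), v j := fun k hk => by
      rw [qResolvent_succ_eq_sum hk, map_add, map_sum]
      simp [hv]
    have hsumne := sum_ne_zero_of_inCone hu hv0 fun j hj => hvcone 0 j (Nat.zero_le _) hj
    have hblock : ∀ a b c d, b ≤ c → d ≤ n + 1 →
        InCone u ((∑ j ∈ Finset.Ico c d, v j) * conj (∑ i ∈ Finset.Ico a b, v i)) :=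
      fun a b c d hbc hd => inCone_sum_mul_conj_sum fun i hi j hj => by
        rw [Finset.mem_Ico] at hi hj
        exact hvcone i j (by omega) (by omega)
    by_cases hmem : n + 1 ∈ S
    · have hX : Φ (X ^ (n + 1)) = (1 + z) * u * ∑ j ∈ Finset.Ico 0 (n + 1), v j := by
        rw [hS' n hmem, hexp 0 (Nat.zero_le _), ← hzu]; ring
      refine ⟨?_, fun i j hij hj => ?_⟩
      · rw [hexp 0 (Nat.zero_le _), hX, ← hzu, add_comm, ← one_add_mul, ← Finset.range_eq_Ico]
        exact mul_ne_zero hz1 hsumne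
      -- Here Φ(t^{n+1}) is z times the sum of all v_j, so terms with j < k get weight z and the
      -- others 1 + z. Factoring out 1 + z explains u = z/(1+z); cutting the sums at i and j gives
      -- the A, M, B of `inCone_step`.
      · have hform : ∀ k ≤ n + 1, Φ (qResolvent q (n + 1) k) = (1 + z) *
            (u * ∑ j ∈ Finset.Ico 0 k, v j + ∑ j ∈ Finset.Ico k (n + 1), v j) := fun k hk => by
          rw [hexp k hk, hX, ← Finset.sum_Ico_consecutive v (Nat.zero_le k) hk]
          linear_combination (-∑ j ∈ Finset.Ico k (n + 1), v j) * hzu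
        have := inCone_step (hblock 0 i i j le_rfl hj) (hblock i j j (n + 1) le_rfl le_rfl)
        rw [Finset.sum_Ico_consecutive v (Nat.zero_le i) hij,
          Finset.sum_Ico_consecutive v hij hj] at this
        rw [hform i (hij.trans hj), hform j hj]
        convert this.real_mul (Complex.normSq_nonneg (1 + z)) using 1
        rw [← Complex.mul_conj, map_mul]
        ring
    -- For a rank outside S the new values are just the tail sums of the v_j.
    · have hX := hS n hmem
      refine ⟨?_, fun i j hij hj => ?_⟩
      · rwa [hexp 0 (Nat.zero_le _), hX, zero_add, ← Finset.range_eq_Ico]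
      · rw [hexp i (hij.trans hj), hexp j hj, hX, zero_add, zero_add,
          ← Finset.sum_Ico_consecutive v hij hj, map_add, mul_add]
        exact (hblock i j j (n + 1) le_rfl le_rfl).add (inCone_mul_conj _)

end UpperHalfPlane

/-! ### Chain polynomials as values of a linear functional -/

section Chains

section General

variable {Q : Type*} [PartialOrder Q] [Fintype Q]

open scoped Classical in
theorem chainPoly_eq_sum :
    chainPoly Q =
      ∑ D ∈ Finset.univ.filter fun D : Finset Q => IsChain (· ≤ ·) (D : Set Q),
        (X : ℝ[X]) ^ D.card := by
  have := Fintype.ofFinite {D : Set Q // IsChain (· ≤ ·) D}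
  rw [chainPoly, finsum_eq_sum_of_fintype]
  refine Finset.sum_bij' (fun D _ => D.1.toFinset)
    (fun D hD => ⟨D, (Finset.mem_filter.1 hD).2⟩) ?_ ?_ ?_ ?_ ?_
  · intro D _; simpa using D.2
  · intro D _; simp
  · intro D _; simp
  · intro D _; simp
  · intro D _; rw [Set.ncard_eq_toFinset_card']

open scoped Classical in
/-- The generating polynomial of the chains with greatest element `x`. -/
noncomputable def topChainPoly (x : Q) : ℝ[X] :=
  ∑ D ∈ Finset.univ.filter fun D : Finset Q =>
    IsChain (· ≤ ·) (D : Set Q) ∧ IsGreatest (D : Set Q) x, X ^ D.card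

-- The summand 1 is the empty chain; every other chain is sorted by its greatest element, and p
-- descends from that element to the whole chain.
open scoped Classical in
theorem sum_chains_lower (p : Q → Prop) (hp : ∀ x y, x ≤ y → p y → p x) :
    ∑ D ∈ Finset.univ.filter fun D : Finset Q =>
      IsChain (· ≤ ·) (D : Set Q) ∧ ∀ y ∈ D, p y, (X : ℝ[X]) ^ D.card =
      1 + ∑ y with p y, topChainPoly y := by
  have hdisj : Set.PairwiseDisjoint (({y | p y} : Finset Q) : Set Q) fun y =>
      Finset.univ.filter fun D : Finset Q =>
        IsChain (· ≤ ·) (D : Set Q) ∧ IsGreatest (D : Set Q) y := by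
    intro y _ y' _ hne
    rw [Function.onFun, Finset.disjoint_left]
    intro D hD hD'
    exact hne ((Finset.mem_filter.1 hD).2.2.unique (Finset.mem_filter.1 hD').2.2)
  have hset : (Finset.univ.filter fun D : Finset Q => IsChain (· ≤ ·) (D : Set Q) ∧ ∀ y ∈ D, p y) =
      insert ∅ (({y | p y} : Finset Q).biUnion fun y => Finset.univ.filter fun D : Finset Q =>
        IsChain (· ≤ ·) (D : Set Q) ∧ IsGreatest (D : Set Q) y) := by
    ext D
    simp only [Finset.mem_filter, Finset.mem_univ, true_and, Finset.mem_insert, Finset.mem_biUnion]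
    constructor
    · rintro ⟨hD, hDp⟩
      rcases D.eq_empty_or_nonempty with h | h
      · exact Or.inl h
      · right
        obtain ⟨y, hy⟩ := D.exists_maximal h
        refine ⟨y, hDp y hy.1, hD, hy.1, fun z hz => ?_⟩
        rcases hD.total hz hy.1 with h1 | h1
        · exact h1
        · exact hy.2 hz h1
    · rintro (rfl | ⟨y, hy, hD, hDy⟩)
      · simp
      · exact ⟨hD, fun z hz => hp z y (hDy.2 hz) hy⟩
  rw [hset, Finset.sum_insert, Finset.sum_biUnion hdisj]
  · simp [topChainPoly]
  · simp only [Finset.mem_biUnion, Finset.mem_filter, Finset.mem_univ, true_and, not_exists,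
      not_and]
    rintro y - - h
    simpa using h.1

open scoped Classical in
theorem chainPoly_eq : chainPoly Q = 1 + ∑ y : Q, topChainPoly y := by
  have := sum_chains_lower (Q := Q) (fun _ => True) (by simp)
  rw [chainPoly_eq_sum]
  simpa using this

open scoped Classical in
theorem topChainPoly_eq (x : Q) :
    topChainPoly x = X * (1 + ∑ y with y < x, topChainPoly y) := by
  rw [← sum_chains_lower (fun y => y < x) (fun _ _ h h' => lt_of_le_of_lt h h'), topChainPoly,
    Finset.mul_sum]
  refine Finset.sum_bij' (fun D _ => D.erase x) (fun D _ => insert x D) ?_ ?_ ?_ ?_ ?_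
  · intro D hD
    obtain ⟨h1, h2⟩ := (Finset.mem_filter.1 hD).2
    simp only [Finset.mem_filter, Finset.mem_univ, true_and]
    refine ⟨h1.mono (by simp), fun y hy => ?_⟩
    rw [Finset.mem_erase] at hy
    exact lt_of_le_of_ne (h2.2 hy.2) hy.1
  · intro D hD
    obtain ⟨h1, h2⟩ := (Finset.mem_filter.1 hD).2
    simp only [Finset.mem_filter, Finset.mem_univ, true_and]
    refine ⟨?_, by simp, fun y hy => ?_⟩
    · rw [Finset.coe_insert]
      exact h1.insert fun y hy _ => Or.inr (h2 y hy).le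
    · rcases Finset.mem_insert.1 hy with rfl | hy
      · exact le_rfl
      · exact (h2 y hy).le
  · intro D hD
    exact Finset.insert_erase (Finset.mem_filter.1 hD).2.2.1
  · intro D hD
    exact Finset.erase_insert fun h => lt_irrefl _ ((Finset.mem_filter.1 hD).2.2 x h)
  · intro D hD
    rw [← pow_succ', Finset.card_erase_add_one (Finset.mem_filter.1 hD).2.2.1]

end General

theorem chainPoly_congr {Q Q' : Type*} [PartialOrder Q] [PartialOrder Q'] [Finite Q] [Finite Q']
    (e : Q ≃o Q') : chainPoly Q = chainPoly Q' := by
  refine finsum_eq_of_bijective (fun D => ⟨e '' D.1, ?_⟩) ⟨?_, ?_⟩ ?_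
  · exact D.2.image_of_map_rel _ _ _ fun _ _ h => e.monotone h
  · intro D D' h
    exact Subtype.ext (e.injective.image_injective (congrArg Subtype.val h))
  · intro D
    refine ⟨⟨e.symm '' D.1, D.2.image_of_map_rel _ _ _ fun _ _ h => e.symm.monotone h⟩,
      Subtype.ext ?_⟩
    simp [Set.image_image]
  · intro D
    rw [Set.ncard_image_of_injective _ e.injective]

/-- The generating function, evaluated at `z`, of the chains with ranks in `S` whose greatest
element is a given element of rank `n`. -/
noncomputable def chainWeight (q : ℝ) (z : ℂ) (S : Set ℕ) (n : ℕ) : ℂ :=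
  open scoped Classical in
  z * (1 + ∑ k : Fin n, if (k : ℕ) ∈ S then
    ((qResolvent q n 0).coeff k : ℂ) * chainWeight q z S k else 0)
termination_by n
decreasing_by exact k.2

open scoped Classical in
theorem chainWeight_eq (q : ℝ) (z : ℂ) (S : Set ℕ) (n : ℕ) :
    chainWeight q z S n = z * (1 + ∑ k ∈ Finset.range n, if k ∈ S then
      ((qResolvent q n 0).coeff k : ℂ) * chainWeight q z S k else 0) := by
  rw [chainWeight, Finset.sum_range]

variable {F : Type*} [Field F] [Finite F] {P : Type*} [PartialOrder P] [Fintype P]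

/-- Removing the greatest element gives a recursion over the ideal below x, whose rank numbers
depend only on the rank of x. -/
theorem aeval_topChainPoly (hP : HasSubspaceIdeals F P) (S : Set ℕ) [Fintype (RankSelected P S)]
    (z : ℂ) (x : RankSelected P S) :
    aeval z (topChainPoly x) = chainWeight (Nat.card F : ℝ) z S (quasiRank (x : P)) := by
  classical
  induction x using WellFoundedLT.induction with
  | _ x ih =>
    rw [topChainPoly_eq, chainWeight_eq, map_mul, aeval_X, map_add, map_one, map_sum]
    congr 2
    have h1 : ∑ y with y < x, aeval z (topChainPoly y) =
        ∑ y ∈ Finset.univ.filter fun y : P => y < x ∧ quasiRank y ∈ S,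
          chainWeight (Nat.card F : ℝ) z S (quasiRank y) := by
      refine Finset.sum_bij (fun y _ => y.1) ?_ ?_ ?_ ?_
      · intro y hy
        simp only [Finset.mem_filter, Finset.mem_univ, true_and] at hy ⊢
        exact ⟨hy, y.2⟩
      · intro y _ y' _ h
        exact Subtype.ext h
      · intro y hy
        simp only [Finset.mem_filter, Finset.mem_univ, true_and] at hy
        exact ⟨⟨y, hy.2⟩, Finset.mem_filter.2 ⟨Finset.mem_univ _, hy.1⟩, rfl⟩
      · intro y hy
        exact ih y (by simpa using hy)
    rw [h1, ← Finset.sum_fiberwise_of_maps_to (t := Finset.range (quasiRank (x : P)))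
      (g := fun y => quasiRank y)]
    · refine Finset.sum_congr rfl fun k hk => ?_
      have hk := Finset.mem_range.1 hk
      rw [Finset.sum_congr rfl (g := fun _ => chainWeight (Nat.card F : ℝ) z S k)
        (fun y hy => by rw [(Finset.mem_filter.1 hy).2]), Finset.sum_const, Finset.filter_filter,
        nsmul_eq_mul, ← hP.idealCount_eq]
      split_ifs with hkS
      · congr 1
        rw [idealCount, Complex.ofReal_natCast, Nat.cast_inj, ← Set.ncard_coe_finset]
        congr 1
        ext y
        simp only [Finset.coe_filter, Finset.mem_univ, true_and, Set.mem_ofPred_eq]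
        constructor
        · rintro ⟨⟨h1, h2⟩, h3⟩; exact ⟨h1.le, h3⟩
        · rintro ⟨h1, h2⟩
          refine ⟨⟨lt_of_le_of_ne h1 ?_, h2 ▸ hkS⟩, h2⟩
          rintro rfl
          omega
      · rw [Finset.filter_eq_empty_iff.2]
        · simp
        · rintro y - ⟨⟨-, h2⟩, h3⟩
          exact hkS (h3 ▸ h2)
    · intro y hy
      exact Finset.mem_range.2 (hP.quasiRank_lt (Finset.mem_filter.1 hy).2.1)

open scoped Classical in
/-- The linear functional that counts chains with ranks in `S`, by the rank of the greatest
element and evaluated at `z`. -/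
noncomputable def chainFunctional (q : ℝ) (z : ℂ) (S : Set ℕ) : ℝ[X] →ₗ[ℝ] ℂ :=
  (basisMonomials ℝ).constr ℝ fun k =>
    (if k = 0 then 1 else 0) + if k ∈ S then chainWeight q z S k else 0

open scoped Classical in
theorem chainFunctional_X_pow (q : ℝ) (z : ℂ) (S : Set ℕ) (k : ℕ) :
    chainFunctional q z S (X ^ k) =
      (if k = 0 then 1 else 0) + if k ∈ S then chainWeight q z S k else 0 := by
  rw [chainFunctional, ← monomial_one_right_eq_X_pow,
    ← congrFun (coe_basisMonomials ℝ) k, Module.Basis.constr_basis]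

/-- Subtracting the leading term of R_{n+1,0} leaves the strictly smaller ranks. The constant
coefficient 1, through the extra 1 in Φ(1), accounts for the chain consisting of its top alone. -/
theorem chainFunctional_recursion (q : ℝ) (z : ℂ) (S : Set ℕ) {n : ℕ} (hn : n + 1 ∈ S) :
    chainFunctional q z S (X ^ (n + 1)) = z * (chainFunctional q z S (qResolvent q (n + 1) 0) -
      chainFunctional q z S (X ^ (n + 1))) := by
  classical
  have hdeg : (qResolvent q (n + 1) 0).natDegree < n + 2 := by
    refine Nat.lt_succ_of_le (natDegree_le_iff_coeff_eq_zero.2 fun _ hj => ?_)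
    exact coeff_qResolvent_of_gt q (Nat.zero_le _) hj
  have hsum : chainFunctional q z S (qResolvent q (n + 1) 0) = ∑ k ∈ Finset.range (n + 2),
      ((qResolvent q (n + 1) 0).coeff k : ℂ) * chainFunctional q z S (X ^ k) := by
    conv_lhs => rw [as_sum_range_C_mul_X_pow' _ hdeg]
    simp [← smul_eq_C_mul]
  rw [hsum, Finset.sum_range_succ, coeff_qResolvent_top q (Nat.zero_le _), Complex.ofReal_one,
    one_mul, add_sub_cancel_right, chainFunctional_X_pow, if_neg (Nat.succ_ne_zero n), if_pos hn,
    zero_add, chainWeight_eq]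
  simp only [chainFunctional_X_pow, mul_add, Finset.sum_add_distrib]
  congr 1
  · rw [Finset.sum_eq_single 0, coeff_qResolvent_bot q (Nat.zero_le _)]
    · simp
    · intro b _ hb; simp [hb]
    · simp
  · simp

/-- The empty chain is charged to the bottom, the only element of rank 0, whether or not 0 belongs
to S. -/
theorem aeval_chainPoly_rankSelected (hP : HasSubspaceIdeals F P) (hb : ∃ b : P, IsBot b)
    (S : Set ℕ) (z : ℂ) :
    aeval z (chainPoly (RankSelected P S)) =
      chainFunctional (Nat.card F : ℝ) z S (rankGenPoly P) := by
  classical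
  obtain ⟨b, hb⟩ := hb
  have := Fintype.ofFinite (RankSelected P S)
  rw [chainPoly_eq, map_add, map_one, map_sum, rankGenPoly, finsum_eq_sum_of_fintype, map_sum]
  simp only [aeval_topChainPoly hP, chainFunctional_X_pow, Finset.sum_add_distrib]
  congr 1
  · rw [Finset.sum_eq_single b]
    · rw [if_pos]
      rw [quasiRank, Order.height_eq_zero.2 hb.isMin]; rfl
    · intro x _ hx
      have := hP.quasiRank_lt (lt_of_le_of_ne (hb x) hx.symm)
      rw [if_neg (by omega)]
    · simp
  · rw [← Finset.sum_filter]
    exact (Finset.sum_subtype (p := fun x => quasiRank x ∈ S)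
      (Finset.univ.filter fun x : P => quasiRank x ∈ S) (by simp)
      (fun x => chainWeight (Nat.card F : ℝ) z S (quasiRank x))).symm

theorem splits_chainPoly_rankSelected (hP : HasSubspaceIdeals F P) (hb : ∃ b : P, IsBot b)
    {n : ℕ} {a : ℕ → ℝ} (ha : ∀ k ≤ n, 0 ≤ a k)
    (hsum : rankGenPoly P =
      ∑ k ∈ Finset.range (n + 1), C (a k) * qResolvent (Nat.card F : ℝ) n k) (S : Set ℕ) :
    (chainPoly (RankSelected P S)).Splits := by
  classical
  set q : ℝ := (Nat.card F : ℝ)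
  have hq : 0 < q := Nat.cast_pos.2 Nat.card_pos
  -- Only R_{n,0} has a nonzero constant term. With h_0 = 1, the first summand of the final sum is
  -- Φ(R_{n,0}), which is nonzero.
  have ha0 : a 0 = 1 := by
    have h1 := coeff_rankGenPoly_zero hP hb
    rw [hsum, coeff_sum_qResolvent, Finset.sum_eq_single 0] at h1
    · simpa [coeff_qResolvent_bot q (Nat.zero_le n)] using h1
    · intro k hk hk0
      rw [coeff_qResolvent_of_lt q (by simpa [Nat.lt_succ_iff] using hk) (Nat.pos_of_ne_zero hk0),
        mul_zero]
    · simp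
  refine splits_of_aeval_ne_zero fun z hz => ?_
  have hz1 : 1 + z ≠ 0 := fun h => by
    have := congrArg Complex.im h
    simp at this; linarith
  have hu : 0 < (z / (1 + z)).im := by
    have : (z / (1 + z)).im = z.im / Complex.normSq (1 + z) := by
      rw [Complex.div_im]; simp; ring
    rw [this]
    exact div_pos hz (Complex.normSq_pos.2 hz1)
  have h01 : chainFunctional q z S 1 ≠ 0 := by
    have := chainFunctional_X_pow q z S 0
    rw [pow_zero] at this
    rw [this, chainWeight_eq]
    by_cases h0 : 0 ∈ S <;> simp [h0, hz1]
  obtain ⟨hne, hcone⟩ := inCone_functional hq hz (chainFunctional q z S) h01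
    (fun n hn => by simp [chainFunctional_X_pow, hn])
    (fun n hn => chainFunctional_recursion q z S hn) n
  rw [aeval_chainPoly_rankSelected hP hb, hsum, map_sum]
  refine sum_ne_zero_of_inCone (v := fun k => chainFunctional q z S (C (a k) * qResolvent q n k))
    hu ?_ fun j hj => ?_
  · simpa [ha0] using hne
  · have := (hcone 0 j (Nat.zero_le _) hj).real_mul (ha j hj)
    simpa [ha0, ← smul_eq_C_mul, mul_assoc] using this

end Chains
end QPoset

/-! ### The theorem -/

theorem theorem7 {F : Type*} [Field F] [Finite F] {P : Type*} [PartialOrder P] [Finite P]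
    (hq : QPoset.IsQPoset F P) (hP : QPoset.IsShellable P)
    (n : ℕ) (hn : QPoset.posetRank P = n) :
    QPoset.IsPositive (QPoset.SubspacePoset F) P ∧
    (∃ h : Fin (n + 1) → ℝ, (∀ k, 0 ≤ h k) ∧
      QPoset.rankGenPoly P =
        ∑ k, Polynomial.C (h k) * QPoset.qResolvent (Nat.card F : ℝ) n k ∧
      ∀ g : Fin (n + 1) → ℝ, QPoset.rankGenPoly P =
        ∑ k, Polynomial.C (g k) * QPoset.qResolvent (Nat.card F : ℝ) n k → g = h) ∧
    (QPoset.chainPoly P).Splits ∧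
    ∀ S : Set ℕ, (QPoset.chainPoly (QPoset.RankSelected P S)).Splits := by
  have hI := hq.hasSubspaceIdeals
  have hb := hq.1.exists_bot
  obtain ⟨n', hpure, m, f, hf⟩ := hP
  obtain rfl : n' = n := by
    have := hpure.posetRank_eq hI
    rw [hn] at this
    exact_mod_cast this.symm
  obtain ⟨a, ha, hsum⟩ := hI.rankGenPoly_expansion hpure f hf
  have hq0 : (Nat.card F : ℝ) ≠ 0 := Nat.cast_ne_zero.2 Nat.card_pos.ne'
  have := Fintype.ofFinite P
  have hsel := QPoset.splits_chainPoly_rankSelected hI hb ha hsum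
  refine ⟨⟨QPoset.isTNPoset_subspacePoset, hI.isCombinatorialPosetOver hb, _, _, n', a,
    QPoset.isResolution_subspacePoset, hn, ha, hsum⟩,
    ⟨fun k => a k, fun k => ha k (Nat.lt_succ_iff.1 k.2), ?_, fun g hg => ?_⟩, ?_, hsel⟩
  · rw [hsum, Finset.sum_range]
  -- Extending g by zero to all of ℕ brings it within reach of the uniqueness lemma.
  · have hg' : ∀ k : Fin (n' + 1),
        (if h : (k : ℕ) < n' + 1 then g ⟨k, h⟩ else 0) = g k :=
      fun k => dif_pos k.2
    have := QPoset.qResolvent_expansion_unique hq0 (n := n') (a := a)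
      (b := fun k : ℕ => if h : k < n' + 1 then g ⟨k, h⟩ else 0) (by
        rw [← hsum, hg, Finset.sum_range]
        exact Finset.sum_congr rfl fun k _ => by rw [hg'])
    funext k
    rw [this k (Nat.lt_succ_iff.1 k.2), hg']
  -- The full chain polynomial is the case in which every rank is selected.
  · rw [QPoset.chainPoly_congr (Q' := QPoset.RankSelected P Set.univ)
      { toFun := fun x => ⟨x, Set.mem_univ _⟩
        invFun := fun x => x.1
        left_inv := fun _ => rfl
        right_inv := fun _ => rfl
        map_rel_iff' := Iff.rfl }]
    exact hsel Set.univ
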